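/- Let $0\le j<k<n$ be integers. For $0\le m<n$ let $\mathcal G_{n,m}$ be the manifold of all (non-oriented) affine $m$-planes $\tau=\xi+u$ in $\mathbb R^n$, where $\xi$ is an $m$-dimensional linear subspace and $u\in\xi^\perp$. It carries the measure $d\tau=d\xi\,du$, where $d\xi$ is the $O(n)$-invariant probability measure on the Grassmannian of $m$-dimensional linear subspaces and $du$ is the Euclidean volume on $\xi^\perp$. Let $|\tau|$ be the Euclidean distance from $\tau$ to the origin. For $1\le p\le\infty$ and $\nu\in\mathbb R$, let $L^p_\nu(\mathcal G_{n,m})$ be the space of (real- or complex-valued) measurable functions $f$, modulo equality almost everywhere, with finite norm $\|f\|_{p,\nu}=\big\|\,|\tau|^\nu f\,\big\|_{L^p(\mathcal G_{n,m})}$. The dual $j$-plane to $k$-plane transform of a function $\varphi$ on $\mathcal G_{n,k}$ is the function on $\mathcal G_{n,j}$ given, for $\zeta=\eta+v$ with $\eta$ a $j$-dimensional linear subspace and $v\in\eta^\perp$, by $$(R_{j,k}^*\varphi)(\zeta)=\int_{O(n-j)}\varphi\big(g_\eta\rho\,\mathbb R^k+v\big)\,d\rho .$$ Here $\mathbb R^m=\mathbb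 Re_1\oplus\cdots\oplus\mathbb Re_m$, $g_\eta\in O(n)$ is any orthogonal transformation with $g_\eta\mathbb R^j=\eta$, and $O(n-j)$ is the orthogonal group of $\mathbb Re_{j+1}\oplus\cdots\oplus\mathbb Re_n$ (acting trivially on $\mathbb R^j$), with its invariant probability measure $d\rho$. **Theorem.** Let $1\le p\le\infty$, $1/p+1/p'=1$, and let $\mu,\nu\in\mathbb R$ satisfy $$\nu=\mu-\frac{k-j}{p},\qquad \mu<\frac{n-k}{p'} .$$ Then for every $\varphi\in L^p_\mu(\mathcal G_{n,k})$ the integral defining $(R_{j,k}^*\varphi)(\zeta)$ converges absolutely for almost every $\zeta\in\mathcal G_{n,j}$, and $R_{j,k}^*$ is a bounded linear operator from $L^p_\mu(\mathcal G_{n,k})$ to $L^p_\nu(\mathcal G_{n,j})$ with operator norm $$\|R_{j,k}^*\|=\pi^{(k-j)/2}\left(\frac{\sigma_{n-k-1}}{\sigma_{n-j-1}}\right)^{1/p'}\frac{\Gamma\!\left(\frac{(n-k)/p'-\mu}{2}\right)}{\Gamma\!\left(\frac{(n-j)/p'+(k-j)/p-\mu}{2}\right)},$$ where $\sigma_{d-1}=2\pi^{d/2}/\Gamma(d/2)$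 is the area of the unit sphere in $\mathbb R^d$. -/

import Mathlib

open MeasureTheory
open scoped ENNReal

noncomputable section

namespace PlaneTransform

/-! ### The orthogonal group and its invariant probability measure -/

/-- Euclidean space `ℝⁿ`. -/
abbrev E (n : ℕ) : Type := EuclideanSpace ℝ (Fin n)

/-- The orthogonal group `O(n)`, with the topology of the space of matrices. -/
abbrev O (n : ℕ) : Type := ↥(Matrix.orthogonalGroup (Fin n) ℝ)

instance (n : ℕ) : MeasurableSpace (O n) := borel _

instance (n : ℕ) : BorelSpace (O n) := ⟨rfl⟩

instance (n : ℕ) : CompactSpace (O n) := by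
  have hcl : IsClosed {A : Fin n → Fin n → ℝ | Matrix.of A ∈ Matrix.orthogonalGroup (Fin n) ℝ} :=
    isClosed_unitary (R := Matrix (Fin n) (Fin n) ℝ)
  have hsub : {A : Fin n → Fin n → ℝ | Matrix.of A ∈ Matrix.orthogonalGroup (Fin n) ℝ} ⊆
      Set.pi Set.univ fun _ => Set.pi Set.univ fun _ => Set.Icc (-1 : ℝ) 1 := by
    intro A hA i _ j _
    have h := entry_norm_bound_of_unitary (𝕜 := ℝ) hA i j
    exact abs_le.1 (by simpa using h)
  have hcpt : IsCompact {A : Fin n → Fin n → ℝ |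
      Matrix.of A ∈ Matrix.orthogonalGroup (Fin n) ℝ} :=
    (isCompact_univ_pi fun _ => isCompact_univ_pi fun _ => isCompact_Icc).of_isClosed_subset
      hcl hsub
  exact isCompact_iff_compactSpace.1 hcpt

/-- The invariant (Haar) probability measure of a compact group. -/
def probHaar (G : Type*) [Group G] [TopologicalSpace G] [IsTopologicalGroup G] [CompactSpace G]
    [MeasurableSpace G] [BorelSpace G] : Measure G :=
  Measure.haarMeasure ⊤

/-- The action of `g ∈ O(n)` on `ℝⁿ`, `x ↦ g x`. -/
def rot {n : ℕ} (g : O n) : E n →ₗ[ℝ] E n := Matrix.toEuclideanLin g.1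

theorem rot_apply {n : ℕ} (g : O n) (x : E n) : rot g x = WithLp.toLp 2 (g.1.mulVec x.ofLp) := rfl

theorem rot_mul {n : ℕ} (g h : O n) (x : E n) : rot (g * h) x = rot g (rot h x) := by
  simp [rot_apply, Matrix.mulVec_mulVec]

theorem rot_one {n : ℕ} (x : E n) : rot (1 : O n) x = x := by
  simp [rot_apply]

theorem rot_inv_rot {n : ℕ} (g : O n) (x : E n) : rot g⁻¹ (rot g x) = x := by
  rw [← rot_mul, inv_mul_cancel, rot_one]

theorem rot_rot_inv {n : ℕ} (g : O n) (x : E n) : rot g (rot g⁻¹ x) = x := by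
  rw [← rot_mul, mul_inv_cancel, rot_one]

theorem rot_injective {n : ℕ} (g : O n) : Function.Injective (rot g) :=
  Function.LeftInverse.injective (rot_inv_rot g)

/-! ### Coordinate planes -/

/-- The coordinate plane `ℝᵏ = ℝe₁ ⊕ ⋯ ⊕ ℝe_k ⊆ ℝⁿ`. -/
def coordPlane (n k : ℕ) : Submodule ℝ (E n) where
  carrier := {x | ∀ i : Fin n, k ≤ i.val → x i = 0}
  add_mem' hx hy i hi := by simp [hx i hi, hy i hi]
  zero_mem' i _ := rfl
  smul_mem' c x hx i hi := by simp [hx i hi]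

/-- The isometric embedding of `ℝⁿ⁻ᵏ` onto the orthogonal complement
`ℝe_{k+1} ⊕ ⋯ ⊕ ℝe_n` of `ℝᵏ` in `ℝⁿ`. -/
def coordCompl {n : ℕ} (k : ℕ) (y : E (n - k)) : E n :=
  WithLp.toLp 2 fun i : Fin n => if h : k ≤ i.val then y ⟨i.val - k, by omega⟩ else 0

theorem finrank_coordPlane {n k : ℕ} (h : k ≤ n) : Module.finrank ℝ (coordPlane n k) = k := by
  let e : coordPlane n k ≃ₗ[ℝ] (Fin k → ℝ) :=
    { toFun := fun x i => x.1 (Fin.castLE h i)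
      map_add' := fun x y => rfl
      map_smul' := fun c x => rfl
      invFun := fun z =>
        ⟨WithLp.toLp 2 fun i : Fin n => if hi : i.val < k then z ⟨i.val, hi⟩ else 0, by
          intro i hi
          simp [not_lt.2 hi]⟩
      left_inv := by
        intro x
        ext i
        by_cases hi : i.val < k
        · simp [hi]
        · simp [hi, x.2 i (not_lt.1 hi)]
      right_inv := by
        intro z
        ext i
        simp }
  rw [e.finrank_eq]
  simp

theorem finrank_map_rot {n k : ℕ} (h : k ≤ n) (g : O n) :
    Module.finrank ℝ ((coordPlane n k).map (rot g)) = k :=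
  (Submodule.equivMapOfInjective (rot g) (rot_injective g)
    (coordPlane n k)).finrank_eq.symm.trans (finrank_coordPlane h)

/-! ### The manifold of affine `k`-planes -/

/-- `𝒢(n,k)`: the non-oriented affine `k`-planes in `ℝⁿ`, `0 ≤ k ≤ n`. -/
def AffPlane {n k : ℕ} (_h : k ≤ n) : Type :=
  {τ : AffineSubspace ℝ (E n) // (τ : Set (E n)).Nonempty ∧ Module.finrank ℝ τ.direction = k}

/-- `|τ|`, the Euclidean distance from the plane `τ` to the origin. -/
def AffPlane.dist {n k : ℕ} {h : k ≤ n} (τ : AffPlane h) : ℝ :=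
  Metric.infDist 0 (τ.1 : Set (E n))

/-- The `k`-plane `g ℝᵏ + x`. -/
def plane {n k : ℕ} (h : k ≤ n) (g : O n) (x : E n) : AffPlane h :=
  ⟨AffineSubspace.mk' x ((coordPlane n k).map (rot g)), AffineSubspace.mk'_nonempty _ _, by
    rw [AffineSubspace.direction_mk', finrank_map_rot h]⟩

/-- The parametrization of `𝒢(n,k)` by `O(n) × ℝⁿ⁻ᵏ`: the pair `(g, y)` gives the plane `ξ + u`
with `ξ = g ℝᵏ` and `u = g y ∈ ξ^⊥`, where `ℝⁿ⁻ᵏ` is identified with the orthogonal complement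
of `ℝᵏ`. -/
def param {n k : ℕ} (h : k ≤ n) (q : O n × E (n - k)) : AffPlane h :=
  plane h q.1 (rot q.1 (coordCompl k q.2))

theorem exists_rot_coordPlane {n k : ℕ} (h : k ≤ n) (W : Submodule ℝ (E n))
    (hW : Module.finrank ℝ W = k) : ∃ g : O n, (coordPlane n k).map (rot g) = W := by
  let b₀ := stdOrthonormalBasis ℝ W
  let v : Fin n → E n := fun i => if hi : i.val < k then (b₀ ⟨i.val, hW.symm ▸ hi⟩ : E n) else 0
  let s : Set (Fin n) := {i | i.val < k}
  have hv : Orthonormal ℝ (s.domRestrict v) := by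
    have h1 : Orthonormal ℝ (fun i => (b₀ i : E n)) :=
      b₀.orthonormal.comp_linearIsometry W.subtypeₗᵢ
    have h2 := h1.comp (fun i : s => (⟨i.1.val, hW.symm ▸ i.2⟩ : Fin (Module.finrank ℝ W)))
      (fun i j hij => Subtype.ext (Fin.ext (by simpa using hij)))
    convert h2 using 1
    ext1 i
    have hi : i.1.val < k := i.2
    simp [v, hi]
  obtain ⟨b, hb⟩ := hv.exists_orthonormalBasis_extension_of_card_eq (by simp)
  have hA : (EuclideanSpace.basisFun (Fin n) ℝ).toBasis.toMatrix b ∈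
      Matrix.orthogonalGroup (Fin n) ℝ :=
    OrthonormalBasis.toMatrix_orthonormalBasis_mem_orthogonal _ _
  let g : O n := ⟨_, hA⟩
  have hg : ∀ x : E n, rot g x = ∑ i, x i • b i := by
    intro x
    ext l
    simp [rot_apply, g, Matrix.mulVec, dotProduct, Module.Basis.toMatrix_apply, mul_comm]
  refine ⟨g, Submodule.eq_of_le_of_finrank_eq ?_ ?_⟩
  · rintro _ ⟨x, hx, rfl⟩
    rw [hg]
    refine Submodule.sum_mem _ fun i _ => ?_
    by_cases hi : i.val < k
    · refine Submodule.smul_mem _ _ ?_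
      rw [hb i hi]
      simp [v, hi]
    · rw [hx i (not_lt.1 hi), zero_smul]
      exact Submodule.zero_mem _
  · rw [hW, finrank_map_rot h]

theorem param_surjective {n k : ℕ} (h : k ≤ n) : Function.Surjective (param h) := by
  rintro ⟨τ, ⟨x, hx⟩, hτ⟩
  obtain ⟨g, hg⟩ := exists_rot_coordPlane h τ.direction hτ
  let y : E (n - k) := WithLp.toLp 2 fun i => rot g⁻¹ x ⟨i.val + k, by omega⟩
  refine ⟨(g, y), Subtype.ext ?_⟩
  change AffineSubspace.mk' (rot g (coordCompl k y)) ((coordPlane n k).map (rot g)) = τ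
  rw [hg]
  refine AffineSubspace.mk'_eq ?_
  suffices hmem : rot g (coordCompl k y) ∈ AffineSubspace.mk' x τ.direction by
    rwa [AffineSubspace.mk'_eq hx] at hmem
  rw [AffineSubspace.mem_mk', ← hg]
  refine ⟨coordCompl k y - rot g⁻¹ x, ?_, ?_⟩
  · intro i hi
    simp [coordCompl, y, hi]
  · rw [map_sub, rot_rot_inv, vsub_eq_sub]

/-- The Borel sets of `𝒢(n,k)`: those whose preimage in `O(n) × ℝⁿ⁻ᵏ` is Borel. -/
instance {n k : ℕ} (h : k ≤ n) : MeasurableSpace (AffPlane h) :=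
  MeasurableSpace.map (param h) inferInstance

/-- The measure `dτ = dξ du` on `𝒢(n,k)`: if `g` is distributed by the invariant probability
measure of `O(n)`, then `ξ = g ℝᵏ` is distributed by the `O(n)`-invariant probability measure `dξ`
on the Grassmann manifold, and for fixed `g` the isometry `y ↦ g y` of `ℝⁿ⁻ᵏ` onto `ξ^⊥` carries
Lebesgue measure to the volume element `du` of `ξ^⊥`. -/
def planeMeasure {n k : ℕ} (h : k ≤ n) : Measure (AffPlane h) :=
  Measure.map (param h) ((probHaar (O n)).prod volume)

/-! ### The dual `j`-plane to `k`-plane transform -/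

/-- The orthogonal group `O(n - j)` of the coordinate plane `ℝe_{j+1} ⊕ ⋯ ⊕ ℝe_n`: the
`ρ ∈ O(n)` that fix `ℝʲ` pointwise. -/
def fixSubgroup (n j : ℕ) : Subgroup (O n) where
  carrier := {ρ | ∀ x ∈ coordPlane n j, rot ρ x = x}
  mul_mem' ha hb x hx := by rw [rot_mul, hb x hx, ha x hx]
  one_mem' x _ := rot_one x
  inv_mem' {a} ha x hx := by
    have := rot_inv_rot a x
    rwa [ha x hx] at this

instance (n j : ℕ) : CompactSpace (fixSubgroup n j) := by
  have : IsClosed (fixSubgroup n j : Set (O n)) := by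
    have : (fixSubgroup n j : Set (O n)) =
        ⋂ x ∈ coordPlane n j, {ρ : O n | rot ρ x = x} := by
      ext ρ; simp [fixSubgroup]
    rw [this]
    refine isClosed_biInter fun x _ => isClosed_eq ?_ continuous_const
    simp only [rot_apply]
    refine (PiLp.continuous_toLp 2 _).comp ?_
    exact Continuous.matrix_mulVec continuous_subtype_val continuous_const
  exact isCompact_iff_compactSpace.1 this.isCompact

/-- Some `(g, y)` with `ζ = g ℝʲ + g y` and `g y` in the orthogonal complement of `g ℝʲ`. -/
def coords {n j : ℕ} {h : j ≤ n} (ζ : AffPlane h) : O n × E (n - j) :=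
  Function.surjInv (param_surjective h) ζ

/-- `g_η ∈ O(n)`, an orthogonal transformation that sends `ℝʲ` to the direction `η` of `ζ`. -/
def frame {n j : ℕ} {h : j ≤ n} (ζ : AffPlane h) : O n := (coords ζ).1

/-- The point `v` of `ζ = η + v` in the orthogonal complement of the direction `η`. -/
def foot {n j : ℕ} {h : j ≤ n} (ζ : AffPlane h) : E n := rot (coords ζ).1 (coordCompl j (coords ζ).2)

/-- The `k`-plane `g_η ρ ℝᵏ + v`, for `ρ ∈ O(n - j)`. When `ρ` is distributed by the invariant
probability measure this is the random `k`-plane through the `j`-plane `ζ`. -/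
def planeThrough {n j k : ℕ} {hj : j ≤ n} (hk : k ≤ n) (ζ : AffPlane hj) (ρ : fixSubgroup n j) :
    AffPlane hk :=
  plane hk (frame ζ * ρ.1) (foot ζ)

/-- The integral that defines `(R*_{j,k} φ)(ζ)` converges absolutely. -/
def DualConverges {𝕜 : Type*} [RCLike 𝕜] {n j k : ℕ} {hj : j ≤ n} {hk : k ≤ n}
    (φ : AffPlane hk → 𝕜) (ζ : AffPlane hj) : Prop :=
  Integrable (fun ρ => φ (planeThrough hk ζ ρ)) (probHaar (fixSubgroup n j))

/-- The dual `j`-plane to `k`-plane transform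
`(R*_{j,k} φ)(ζ) = ∫_{O(n-j)} φ(g_η ρ ℝᵏ + v) dρ`, for `ζ = η + v ∈ 𝒢(n,j)`. -/
def dualTransform {𝕜 : Type*} [RCLike 𝕜] {n j k : ℕ} {hj : j ≤ n} {hk : k ≤ n}
    (φ : AffPlane hk → 𝕜) (ζ : AffPlane hj) : 𝕜 :=
  ∫ ρ, φ (planeThrough hk ζ ρ) ∂(probHaar (fixSubgroup n j))

/-! ### Weighted Lebesgue spaces -/

section WeightedLp

variable {X : Type*} [MeasurableSpace X] (𝕜 : Type*) [RCLike 𝕜]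

/-- The weighted space `Lᵖ(X; w) = {f : ‖w f‖_p < ∞}` of classes of almost everywhere equal
measurable functions, as a subspace of the space of all such classes. -/
def wLpSubmodule (w : X → ℝ) (p : ℝ≥0∞) (m : Measure X) : Submodule 𝕜 (X →ₘ[m] 𝕜) where
  carrier := {f | MemLp (fun x => w x • f x) p m}
  add_mem' := by
    intro f g hf hg
    refine (hf.add hg).ae_eq ?_
    filter_upwards [AEEqFun.coeFn_add f g] with x hx
    simp [hx, smul_add]
  zero_mem' := by
    refine (MemLp.zero (ε := 𝕜)).ae_eq ?_
    filter_upwards [AEEqFun.coeFn_zero (α := X) (μ := m) (β := 𝕜)] with x hx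
    simp [hx]
  smul_mem' := by
    intro c f hf
    refine (hf.const_smul c).ae_eq ?_
    filter_upwards [AEEqFun.coeFn_smul c f] with x hx
    simp only [Pi.smul_apply, hx]
    exact smul_comm _ _ _

variable (w : X → ℝ) (p : ℝ≥0∞) (m : Measure X)

/-- The map `f ↦ w f` from `Lᵖ(X; w)` to `Lᵖ(X)`. -/
def mulWeight : wLpSubmodule 𝕜 w p m →ₗ[𝕜] Lp 𝕜 p m where
  toFun f := MemLp.toLp (fun x => w x • (f.1 : X →ₘ[m] 𝕜) x) f.2
  map_add' f g := by
    refine (MemLp.toLp_eq_toLp_iff _ (f.2.add g.2)).2 ?_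
    filter_upwards [AEEqFun.coeFn_add f.1 g.1] with x hx
    simp [hx, smul_add]
  map_smul' c f := by
    refine (MemLp.toLp_eq_toLp_iff _ (f.2.const_smul c)).2 ?_
    filter_upwards [AEEqFun.coeFn_smul c f.1] with x hx
    simp only [Submodule.coe_smul, Pi.smul_apply, hx]
    exact smul_comm _ _ _

/-- The weighted space `Lᵖ(X; w)`; it carries the norm `‖w f‖_p`. -/
def WLp : Type _ := ↥(wLpSubmodule 𝕜 w p m)

instance : AddCommGroup (WLp 𝕜 w p m) := inferInstanceAs (AddCommGroup ↥(wLpSubmodule 𝕜 w p m))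

instance : Module 𝕜 (WLp 𝕜 w p m) := inferInstanceAs (Module 𝕜 ↥(wLpSubmodule 𝕜 w p m))

instance : CoeFun (WLp 𝕜 w p m) fun _ => X → 𝕜 := ⟨fun f => (f.1 : X → 𝕜)⟩

/-- The norm `‖f‖_{p,w} = ‖w f‖_p`. (It separates points when `w ≠ 0` almost everywhere.) -/
instance [Fact (1 ≤ p)] : SeminormedAddCommGroup (WLp 𝕜 w p m) :=
  SeminormedAddCommGroup.induced _ _ (mulWeight 𝕜 w p m)

instance [Fact (1 ≤ p)] : NormedSpace 𝕜 (WLp 𝕜 w p m) :=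
  NormedSpace.induced 𝕜 (WLp 𝕜 w p m) (Lp 𝕜 p m) (mulWeight 𝕜 w p m)

variable {𝕜 w p m}

/-- The norm of `Lᵖ(X; w)`, for a function. -/
theorem WLp.norm_def [Fact (1 ≤ p)] (f : WLp 𝕜 w p m) :
    ‖f‖ = (eLpNorm (fun x => w x • f x) p m).toReal :=
  Lp.norm_toLp _ f.2

/-- The class in `Lᵖ(X; w)` of a measurable function `f` with `‖w f‖_p < ∞`. -/
def WLp.mk (f : X → 𝕜) (hf : AEStronglyMeasurable f m)
    (hwf : MemLp (fun x => w x • f x) p m) : WLp 𝕜 w p m :=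
  ⟨AEEqFun.mk f hf, hwf.ae_eq (by
    filter_upwards [AEEqFun.coeFn_mk f hf] with x hx
    simp [hx])⟩

end WeightedLp

/-- The weight `|τ|^ν` on `𝒢(n,k)`. -/
def distPow {n k : ℕ} (h : k ≤ n) (ν : ℝ) (τ : AffPlane h) : ℝ := τ.dist ^ ν

/-- `L^p_ν(𝒢(n,k))`, the weighted `Lᵖ` space with the weight `|τ|^ν`. -/
abbrev PlaneLp (𝕜 : Type*) [RCLike 𝕜] {n k : ℕ} (h : k ≤ n) (p : ℝ≥0∞) (ν : ℝ) : Type _ :=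
  WLp 𝕜 (distPow h ν) p (planeMeasure h)

/-- `σ_{d-1} = 2 π^{d/2} / Γ(d/2)`, the area of the unit sphere `S^{d-1}` in `ℝᵈ`. -/
def sphereArea (d : ℕ) : ℝ := 2 * Real.pi ^ ((d : ℝ) / 2) / Real.Gamma ((d : ℝ) / 2)

end PlaneTransform

end

noncomputable section

namespace PlaneTransform

/-! ### Linear algebra of the coordinate planes -/

/-! Write d = n - j, d' = n - k, m = k - j and a = d'/p + μ. The condition μ < d'/p' says exactly
that a < d'. In the coordinates (g, y) ∈ O(n) × ℝᵈ of a j-plane ζ, the k-planes through ζ have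
coordinates (gρ, last d' coordinates of ρ⁻¹y). Two facts about this family carry the proof.

Incidence formula (`lintegral_paramThrough`): for each ρ the map (g, y) ↦ (gρ, ρ⁻¹y) preserves both
the measure and |y|. Integration over pairs ζ ⊂ τ can therefore be done over τ first and then over z
∈ ℝᵐ, with |ζ|² = |z|² + |τ|². Moments (`lowerDual_edist`): by homogeneity and rotation invariance
the mean of |τ|^{-a} over the k-planes through ζ is M(a)|ζ|^{-a}, where M is `momentConst`; a
Gaussian integral gives M.

Upper bound, for finite p: Hölder with the weight |τ|^{-a} bounds (R*G)^p by (M|ζ|^{-a})^{p-1}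
R*(|τ|^{a(p-1)}G^p). After multiplication by |ζ|^{νp} the exponent of |ζ| is a - d. The incidence
formula leaves the integral of (|τ|² + |z|²)^{(a-d)/2} over z, equal to K|τ|^{a-d'}, and the powers
of |τ| add up to μp. Since K = M(a) σ_{d-1}/σ_{d'-1}, the p-th root of M^{p-1}K is the stated norm.
For p = ∞ one applies R* to the pointwise bound |φ| ≤ B|τ|^{-μ}.

Lower bound: the power |τ|^{-a} would give equality in Hölder, but for finite p it just fails to lie
in the space. One tests with |τ|^{δ-a} on |τ| < 1. A k-plane through ζ is no farther from the origin
than ζ, so for |ζ| < 1 the cutoff is invisible and the moment formula applies. The ratio of the two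
norms is (σ_{d-1}/σ_{d'-1})^{1/p} for every δ > 0, and δ → 0 gives the constant by continuity of M.
For p = ∞ the choice δ = 0 is already admissible. -/

theorem norm_rot {n : ℕ} (g : O n) (x : E n) : ‖rot g x‖ = ‖x‖ := by
  have h : ‖rot g x‖ ^ 2 = ‖x‖ ^ 2 := by
    rw [EuclideanSpace.real_norm_sq_eq, EuclideanSpace.real_norm_sq_eq]
    have h1 : ∀ v : E n, ∑ i, v i ^ 2 = v.ofLp ⬝ᵥ v.ofLp := fun v => by
      simp [dotProduct, sq]
    rw [h1, h1, rot_apply]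
    have hg : (g.1).transpose * g.1 = 1 := (Matrix.mem_orthogonalGroup_iff' _ _).1 g.2
    simp only
    rw [Matrix.dotProduct_mulVec, Matrix.vecMul_mulVec, hg, Matrix.vecMul_one]
  exact (sq_eq_sq₀ (norm_nonneg _) (norm_nonneg _)).1 h

/-- The linear isometry `x ↦ g x`. -/
def rotₗᵢ {n : ℕ} (g : O n) : E n →ₗᵢ[ℝ] E n := ⟨rot g, norm_rot g⟩

theorem inner_rot {n : ℕ} (g : O n) (x y : E n) : inner ℝ (rot g x) (rot g y) = inner ℝ x y :=
  (rotₗᵢ g).inner_map_map x y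

/-- Every linear isometry of `ℝⁿ` is given by an orthogonal matrix. -/
theorem exists_rot_eq {n : ℕ} (f : E n →ₗᵢ[ℝ] E n) : ∃ g : O n, ∀ x, rot g x = f x := by
  let e : E n ≃ₗᵢ[ℝ] E n := f.toLinearIsometryEquiv rfl
  let b : OrthonormalBasis (Fin n) ℝ (E n) := (EuclideanSpace.basisFun (Fin n) ℝ).map e
  have hA : (EuclideanSpace.basisFun (Fin n) ℝ).toBasis.toMatrix b ∈
      Matrix.orthogonalGroup (Fin n) ℝ :=
    OrthonormalBasis.toMatrix_orthonormalBasis_mem_orthogonal _ _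
  refine ⟨⟨_, hA⟩, fun x => ?_⟩
  have h1 : rot ⟨_, hA⟩ x = ∑ i, x i • b i := by
    ext l
    simp [rot_apply, Matrix.mulVec, dotProduct, Module.Basis.toMatrix_apply, mul_comm]
  have h2 : f x = e x := rfl
  rw [h1, h2]
  conv_rhs => rw [← (EuclideanSpace.basisFun (Fin n) ℝ).sum_repr x]
  simp [b]

/-- The last `n - k` coordinates of a vector. -/
def tailProj {n : ℕ} (k : ℕ) : E n →ₗ[ℝ] E (n - k) where
  toFun x := WithLp.toLp 2 fun i => x ⟨i.val + k, by omega⟩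
  map_add' _ _ := rfl
  map_smul' _ _ := rfl

theorem tailProj_apply {n k : ℕ} (x : E n) (i : Fin (n - k)) :
    tailProj k x i = x ⟨i.val + k, by omega⟩ := rfl

/-- `coordCompl` as a linear map. -/
def coordComplₗ {n : ℕ} (k : ℕ) : E (n - k) →ₗ[ℝ] E n where
  toFun := coordCompl k
  map_add' x y := by ext i; by_cases h : k ≤ i.val <;> simp [coordCompl, h]
  map_smul' c x := by ext i; by_cases h : k ≤ i.val <;> simp [coordCompl, h]

@[simp] theorem tailProj_coordCompl {n k : ℕ} (y : E (n - k)) :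
    tailProj k (coordCompl (n := n) k y) = y := by
  ext i
  simp [tailProj_apply, coordCompl]

theorem sub_coordCompl_tailProj_mem {n k : ℕ} (x : E n) :
    x - coordCompl k (tailProj k x) ∈ coordPlane n k := by
  intro i hi
  simp [coordCompl, tailProj_apply, hi]

theorem coordCompl_tailProj {n k : ℕ} {x : E n} (hx : ∀ i : Fin n, i.val < k → x i = 0) :
    coordCompl k (tailProj k x) = x := by
  ext i
  by_cases hi : k ≤ i.val
  · simp [coordCompl, tailProj_apply, hi]
  · simp [coordCompl, hi, hx i (not_le.1 hi)]

theorem inner_coordPlane_coordCompl {n k : ℕ} {x : E n} (hx : x ∈ coordPlane n k)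
    (y : E (n - k)) : inner ℝ x (coordCompl k y) = 0 := by
  rw [PiLp.inner_apply]
  refine Finset.sum_eq_zero fun i _ => ?_
  by_cases hi : k ≤ i.val
  · simp [hx i hi]
  · simp [coordCompl, hi]

theorem eq_zero_of_inner_coordPlane {n k : ℕ} {x : E n}
    (hx : ∀ y ∈ coordPlane n k, inner ℝ x y = 0) (i : Fin n) (hi : i.val < k) : x i = 0 := by
  have h := hx (EuclideanSpace.single i 1) fun l hl => by
    have : l ≠ i := by rintro rfl; omega
    simp [this]
  rw [EuclideanSpace.inner_single_right] at h
  simpa using h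

theorem coordPlane_mono {n j k : ℕ} (h : j ≤ k) : coordPlane n j ≤ coordPlane n k :=
  fun _ hx i hi => hx i (h.trans hi)

theorem norm_coordCompl {n k : ℕ} (y : E (n - k)) : ‖coordCompl (n := n) k y‖ = ‖y‖ := by
  have h1 : ‖y‖ ^ 2 = ∑ i : Fin (n - k), y i ^ 2 := EuclideanSpace.real_norm_sq_eq y
  have h2 := EuclideanSpace.real_norm_sq_eq (coordCompl (n := n) k y)
  refine (sq_eq_sq₀ (norm_nonneg _) (norm_nonneg _)).1 (h2.trans (Eq.trans ?_ h1.symm))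
  symm
  refine Finset.sum_of_injOn (fun i : Fin (n - k) => (⟨i.val + k, by omega⟩ : Fin n))
    (fun a _ b _ h => Fin.ext (by simpa using h)) (fun _ _ => Finset.mem_coe.2 (Finset.mem_univ _))
    ?_ ?_
  · intro i _ hi
    by_cases hk : k ≤ i.val
    · exact absurd ⟨⟨i.val - k, by omega⟩, by simp, Fin.ext (by simp [hk])⟩ hi
    · simp [coordCompl, hk]
  · intro i _
    simp [coordCompl]

/-! ### Planes in coordinates -/

theorem plane_eq_plane {n k : ℕ} (h : k ≤ n) {g g' : O n} {x x' : E n}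
    (hg : (coordPlane n k).map (rot g) = (coordPlane n k).map (rot g'))
    (hx : x - x' ∈ (coordPlane n k).map (rot g)) : plane h g x = plane h g' x' := by
  refine Subtype.ext ?_
  change AffineSubspace.mk' x ((coordPlane n k).map (rot g)) =
    AffineSubspace.mk' x' ((coordPlane n k).map (rot g'))
  rw [← hg]
  have := AffineSubspace.mk'_eq (p := x') (s := AffineSubspace.mk' x ((coordPlane n k).map (rot g)))
    (by
      rw [AffineSubspace.mem_mk', vsub_eq_sub, ← neg_sub]
      exact Submodule.neg_mem _ hx)
  rw [AffineSubspace.direction_mk'] at this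
  exact this.symm

theorem plane_eq_param {n k : ℕ} (h : k ≤ n) (g : O n) (x : E n) :
    plane h g x = param h (g, tailProj k (rot g⁻¹ x)) := by
  refine plane_eq_plane h rfl ⟨_, sub_coordCompl_tailProj_mem (rot g⁻¹ x), ?_⟩
  rw [map_sub, rot_rot_inv]

theorem dist_param {n k : ℕ} (h : k ≤ n) (q : O n × E (n - k)) :
    (param h q).dist = ‖q.2‖ := by
  obtain ⟨g, y⟩ := q
  have hmem : rot g (coordCompl k y) ∈ ((param h (g, y)).1 : Set (E n)) :=
    AffineSubspace.self_mem_mk' _ _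
  refine le_antisymm ?_ ?_
  · refine (Metric.infDist_le_dist_of_mem hmem).trans_eq ?_
    rw [dist_zero_left, norm_rot, norm_coordCompl]
  · refine (Metric.le_infDist ⟨_, hmem⟩).2 fun x hx => ?_
    have hx' : x -ᵥ rot g (coordCompl k y) ∈ (coordPlane n k).map (rot g) :=
      AffineSubspace.mem_mk'.1 hx
    obtain ⟨w, hw, hwx⟩ := hx'
    have : x = rot g (w + coordCompl k y) := by
      rw [map_add, hwx, vsub_eq_sub, sub_add_cancel]
    rw [dist_zero_left, this, norm_rot]
    have hp := norm_add_sq_eq_norm_sq_add_norm_sq_of_inner_eq_zero _ _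
      (inner_coordPlane_coordCompl hw y)
    rw [norm_coordCompl] at hp
    nlinarith [norm_nonneg w, norm_nonneg y, norm_nonneg (w + coordCompl k y)]

theorem param_coords {n j : ℕ} {h : j ≤ n} (ζ : AffPlane h) : param h (coords ζ) = ζ :=
  Function.surjInv_eq (param_surjective h) ζ

theorem inner_rot_coordCompl {n j : ℕ} (ρ : fixSubgroup n j) (y : E (n - j)) {x : E n}
    (hx : x ∈ coordPlane n j) : inner ℝ (rot ρ.1 (coordCompl j y)) x = 0 := by
  have := ρ.2 x hx
  rw [← this, inner_rot, real_inner_comm, inner_coordPlane_coordCompl hx]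

theorem coordCompl_tailProj_rot {n j : ℕ} (ρ : fixSubgroup n j) (y : E (n - j)) :
    coordCompl j (tailProj j (rot ρ.1 (coordCompl j y))) = rot ρ.1 (coordCompl j y) :=
  coordCompl_tailProj (eq_zero_of_inner_coordPlane fun _ hx => inner_rot_coordCompl ρ y hx)

/-- The linear isometry of `ℝⁿ⁻ʲ` induced by an element of `O(n - j)`. -/
def actCompl {n j : ℕ} (ρ : fixSubgroup n j) : E (n - j) ≃ₗᵢ[ℝ] E (n - j) :=
  LinearIsometry.toLinearIsometryEquiv
    ⟨tailProj j ∘ₗ rot ρ.1 ∘ₗ coordComplₗ j, fun y => by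
      change ‖tailProj j (rot ρ.1 (coordCompl j y))‖ = ‖y‖
      rw [← norm_coordCompl, coordCompl_tailProj_rot, norm_rot, norm_coordCompl]⟩ rfl

theorem coordCompl_actCompl {n j : ℕ} (ρ : fixSubgroup n j) (y : E (n - j)) :
    coordCompl j (actCompl ρ y) = rot ρ.1 (coordCompl j y) :=
  coordCompl_tailProj_rot ρ y

theorem coordCompl_injective {n j : ℕ} : Function.Injective (coordCompl (n := n) j) :=
  Function.LeftInverse.injective tailProj_coordCompl

theorem actCompl_mul {n j : ℕ} (ρ σ : fixSubgroup n j) (y : E (n - j)) :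
    actCompl (ρ * σ) y = actCompl ρ (actCompl σ y) := by
  apply coordCompl_injective
  rw [coordCompl_actCompl, coordCompl_actCompl, coordCompl_actCompl, ← rot_mul]
  rfl

/-- `O(n - j)` acts transitively on the spheres of `ℝⁿ⁻ʲ`. -/
theorem exists_actCompl_eq {n j : ℕ} {y y' : E (n - j)} (h : ‖y‖ = ‖y'‖) :
    ∃ ρ : fixSubgroup n j, actCompl ρ y = y' := by
  let v : E n := coordCompl j y
  let v' : E n := coordCompl j y'
  have hv : ‖v‖ = ‖v'‖ := by rw [norm_coordCompl, norm_coordCompl, h]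
  -- The reflection that swaps v and v' works: v - v' is orthogonal to ℝʲ, so ℝʲ lies in the mirror
  -- and is fixed pointwise.
  obtain ⟨g, hg⟩ := exists_rot_eq ((ℝ ∙ (v - v'))ᗮ.reflection).toLinearIsometry
  refine ⟨⟨g, fun x hx => ?_⟩, ?_⟩
  · rw [hg]
    refine Submodule.reflection_mem_subspace_eq_self ?_
    rw [Submodule.mem_orthogonal_singleton_iff_inner_left, inner_sub_right,
      inner_coordPlane_coordCompl hx, inner_coordPlane_coordCompl hx, sub_zero]
  · apply coordCompl_injective
    rw [coordCompl_actCompl, hg]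
    exact Submodule.reflection_sub hv

/-- The last `n - k` of the coordinates `j + 1, …, n`. -/
def compTail (n j k : ℕ) : E (n - j) →ₗ[ℝ] E (n - k) := tailProj k ∘ₗ coordComplₗ j

theorem compTail_apply {n j k : ℕ} (y : E (n - j)) :
    compTail n j k y = tailProj k (coordCompl j y) := rfl

/-- Pulling the base point g y back by (gρ)⁻¹ gives ρ⁻¹y; only its component orthogonal to ℝᵏ
matters for the plane. -/
theorem plane_mul_eq_param {n j k : ℕ} (hk : k ≤ n) (g : O n) (ρ : fixSubgroup n j)
    (y : E (n - j)) : plane hk (g * ρ.1) (rot g (coordCompl j y)) =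
      param hk (g * ρ.1, compTail n j k (actCompl ρ⁻¹ y)) := by
  rw [plane_eq_param, compTail_apply, coordCompl_actCompl, mul_inv_rev, rot_mul, rot_inv_rot]
  rfl

/-- The difference of two feet of one plane lies in its direction and is also orthogonal to that
direction, hence vanishes. This controls the arbitrary choice made in `coords`. -/
theorem foot_eq_of_param_eq {n j : ℕ} {hj : j ≤ n} {q q' : O n × E (n - j)}
    (h : param hj q = param hj q') :
    (coordPlane n j).map (rot q.1) = (coordPlane n j).map (rot q'.1) ∧
      rot q.1 (coordCompl j q.2) = rot q'.1 (coordCompl j q'.2) := by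
  have h1 : AffineSubspace.mk' (rot q.1 (coordCompl j q.2)) ((coordPlane n j).map (rot q.1)) =
      AffineSubspace.mk' (rot q'.1 (coordCompl j q'.2)) ((coordPlane n j).map (rot q'.1)) :=
    congrArg Subtype.val h
  have hd := congrArg AffineSubspace.direction h1
  rw [AffineSubspace.direction_mk', AffineSubspace.direction_mk'] at hd
  refine ⟨hd, ?_⟩
  have hmem : rot q.1 (coordCompl j q.2) ∈ AffineSubspace.mk' (rot q'.1 (coordCompl j q'.2))
      ((coordPlane n j).map (rot q'.1)) := h1 ▸ AffineSubspace.self_mem_mk' _ _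
  rw [AffineSubspace.mem_mk', vsub_eq_sub] at hmem
  have horth : ∀ (q : O n × E (n - j)), ∀ z ∈ (coordPlane n j).map (rot q.1),
      inner ℝ z (rot q.1 (coordCompl j q.2)) = 0 := by
    rintro q _ ⟨w, hw, rfl⟩
    rw [inner_rot, inner_coordPlane_coordCompl hw]
  have h2 := horth q' _ hmem
  have h3 := horth q _ (hd ▸ hmem)
  have h4 : inner ℝ (rot q.1 (coordCompl j q.2) - rot q'.1 (coordCompl j q'.2))
      (rot q.1 (coordCompl j q.2) - rot q'.1 (coordCompl j q'.2)) = 0 := by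
    rw [inner_sub_right, h2, h3, sub_zero]
  exact sub_eq_zero.1 (inner_self_eq_zero.1 h4)

/-- The isometry that is the identity on `ℝʲ` and agrees on its orthogonal complement with
a given `σ ∈ O(n)` that preserves `ℝʲ`. -/
theorem exists_fixSubgroup_eq_on_compl {n j : ℕ} (σ : O n)
    (hσ : (coordPlane n j).map (rot σ) = coordPlane n j) :
    ∃ β : fixSubgroup n j, ∀ y, rot β.1 (coordCompl j y) = rot σ (coordCompl j y) := by
  let f : E n →ₗ[ℝ] E n :=
    (LinearMap.id - coordComplₗ j ∘ₗ tailProj j) + rot σ ∘ₗ coordComplₗ j ∘ₗ tailProj j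
  have hf : ∀ x, f x = (x - coordCompl j (tailProj j x)) + rot σ (coordCompl j (tailProj j x)) :=
    fun x => rfl
  have horth : ∀ x ∈ coordPlane n j, ∀ y, inner ℝ x (rot σ (coordCompl j y)) = 0 := by
    intro x hx y
    rw [← hσ] at hx
    obtain ⟨w, hw, rfl⟩ := hx
    rw [inner_rot, inner_coordPlane_coordCompl hw]
  obtain ⟨β, hβ⟩ := exists_rot_eq ⟨f, fun x => by
    have h1 := norm_add_sq_eq_norm_sq_add_norm_sq_of_inner_eq_zero _ _
      (horth _ (sub_coordCompl_tailProj_mem x) (tailProj j x))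
    have h2 := norm_add_sq_eq_norm_sq_add_norm_sq_of_inner_eq_zero _ _
      (inner_coordPlane_coordCompl (sub_coordCompl_tailProj_mem x) (tailProj j x))
    rw [← hf, norm_rot] at h1
    rw [sub_add_cancel] at h2
    exact (mul_self_inj (norm_nonneg _) (norm_nonneg _)).1 (h1.trans h2.symm)⟩
  refine ⟨⟨β, fun x hx => ?_⟩, fun y => ?_⟩
  · have h0 : tailProj j x = 0 := by
      ext i
      exact hx ⟨i.val + j, by omega⟩ (by simp)
    have h00 : coordCompl (n := n) j 0 = 0 := (coordComplₗ j).map_zero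
    rw [hβ]
    change f x = x
    rw [hf, h0, h00, map_zero, sub_zero, add_zero]
  · rw [hβ]
    change f _ = _
    rw [hf, tailProj_coordCompl, sub_self, zero_add]

/-- Up to a fixed rotation `β ∈ O(n - j)`, the `k`-planes through `g ℝʲ + g y` do not depend on
the choice of the parameters `(g, y)`. -/
theorem exists_planeThrough_param {n j k : ℕ} (hjk : j ≤ k) (hj : j ≤ n) (hk : k ≤ n) (g : O n)
    (y : E (n - j)) : ∃ β : fixSubgroup n j, ∀ ρ : fixSubgroup n j,
      planeThrough hk (param hj (g, y)) ρ =
        param hk (g * (β * ρ).1, compTail n j k (actCompl (β * ρ)⁻¹ y)) := by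
  obtain ⟨hdir, hfoot⟩ := foot_eq_of_param_eq (param_coords (param hj (g, y)))
  set g' := frame (param hj (g, y)) with hg'
  change (coordPlane n j).map (rot g') = (coordPlane n j).map (rot g) at hdir
  change foot (param hj (g, y)) = rot g (coordCompl j y) at hfoot
  -- Both frames carry ℝʲ to the same direction, so g⁻¹g' preserves ℝʲ. Its action on the orthogonal
  -- complement is the rotation β, and changing the frame amounts to replacing ρ by βρ.
  have hσ : (coordPlane n j).map (rot (g⁻¹ * g')) = coordPlane n j := by
    have h1 : rot (g⁻¹ * g') = rot g⁻¹ ∘ₗ rot g' := LinearMap.ext fun x => rot_mul _ _ x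
    have h2 : rot g⁻¹ ∘ₗ rot g = LinearMap.id := LinearMap.ext fun x => rot_inv_rot _ x
    rw [h1, Submodule.map_comp, hdir, ← Submodule.map_comp, h2, Submodule.map_id]
  obtain ⟨β, hβ⟩ := exists_fixSubgroup_eq_on_compl _ hσ
  refine ⟨β, fun ρ => ?_⟩
  rw [← plane_mul_eq_param]
  have hle : (coordPlane n k).map (rot (g' * ρ.1)) ≤
      (coordPlane n k).map (rot (g * (β * ρ).1)) := by
    rintro _ ⟨x, hx, rfl⟩
    set a := x - coordCompl j (tailProj j x) with ha
    set b := tailProj j x with hb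
    have haj : a ∈ coordPlane n j := sub_coordCompl_tailProj_mem x
    have hx' : x = a + coordCompl j b := by rw [ha, sub_add_cancel]
    have hσa : rot (g⁻¹ * g') a ∈ coordPlane n j := by
      rw [← hσ]
      exact ⟨a, haj, rfl⟩
    have hbk : coordCompl j b ∈ coordPlane n k := by
      have : coordCompl j b = x - a := by rw [ha, sub_sub_cancel]
      rw [this]
      exact Submodule.sub_mem _ hx (coordPlane_mono hjk haj)
    refine ⟨rot (g⁻¹ * g') a + coordCompl j b,
      Submodule.add_mem _ (coordPlane_mono hjk hσa) hbk, ?_⟩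
    have h1 : rot (g * (β * ρ).1) (rot (g⁻¹ * g') a) = rot g' a := by
      rw [rot_mul, (β * ρ).2 _ hσa, ← rot_mul, mul_inv_cancel_left]
    have h2 : rot (g * (β * ρ).1) (coordCompl j b) = rot g' (rot ρ.1 (coordCompl j b)) := by
      rw [rot_mul]
      change rot g (rot (β.1 * ρ.1) _) = _
      rw [rot_mul, ← coordCompl_actCompl, hβ, ← rot_mul, mul_inv_cancel_left]
    rw [map_add, h1, h2, hx', map_add, rot_mul, rot_mul, ρ.2 a haj]
  have heq := Submodule.eq_of_le_of_finrank_eq hle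
    (by rw [finrank_map_rot hk, finrank_map_rot hk])
  refine plane_eq_plane hk heq ?_
  rw [hfoot, sub_self]
  exact Submodule.zero_mem _

/-! ### Radial integrals -/

theorem sphereArea_pos {d : ℕ} (hd : 0 < d) : 0 < sphereArea d := by
  have : (0 : ℝ) < d := by exact_mod_cast hd
  exact div_pos (mul_pos two_pos (Real.rpow_pos_of_pos Real.pi_pos _))
    (Real.Gamma_pos_of_pos (by positivity))

/-- Polar coordinates; the factor d · vol(B) equals σ_{d-1} because Γ(d/2 + 1) = (d/2) Γ(d/2). -/
theorem lintegral_radial {d : ℕ} (hd : 0 < d) (f : ℝ → ℝ) (hf : ∀ r, 0 ≤ r → 0 ≤ f r)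
    (hint : IntegrableOn (fun r : ℝ => r ^ (d - 1) * f r) (Set.Ioi 0)) :
    ∫⁻ u : E d, ENNReal.ofReal (f ‖u‖) =
      ENNReal.ofReal (sphereArea d * ∫ r in Set.Ioi (0 : ℝ), r ^ (d - 1) * f r) := by
  have : Nonempty (Fin d) := ⟨⟨0, hd⟩⟩
  have hd' : (0 : ℝ) < d := by exact_mod_cast hd
  have hi : Integrable (fun u : E d => f ‖u‖) := by
    rw [integrable_fun_norm_addHaar volume (f := f)]
    simpa using hint
  rw [← ofReal_integral_eq_lintegral_ofReal hi (.of_forall fun u => hf _ (norm_nonneg u)),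
    integral_fun_norm_addHaar volume f]
  congr 1
  have hball : (volume : Measure (E d)).real (Metric.ball 0 1) =
      √Real.pi ^ d / Real.Gamma (d / 2 + 1) := by
    rw [measureReal_def, EuclideanSpace.volume_ball]
    have : 0 ≤ √Real.pi ^ d / Real.Gamma (d / 2 + 1) :=
      div_nonneg (by positivity) (Real.Gamma_pos_of_pos (by positivity)).le
    simp [this]
  have hsq : √Real.pi ^ d = Real.pi ^ ((d : ℝ) / 2) := by
    rw [Real.sqrt_eq_rpow, ← Real.rpow_natCast, ← Real.rpow_mul Real.pi_pos.le]
    congr 1; ring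
  rw [hball, hsq, Real.Gamma_add_one (by positivity), sphereArea]
  have : Real.Gamma ((d : ℝ) / 2) ≠ 0 := (Real.Gamma_pos_of_pos (by positivity)).ne'
  simp only [finrank_euclideanSpace, Fintype.card_fin, smul_eq_mul, nsmul_eq_mul]
  field_simp

theorem enorm_rpow_eq_ofReal {V : Type*} [NormedAddCommGroup V] {u : V} (hu : u ≠ 0) (c : ℝ) :
    ‖u‖ₑ ^ c = ENNReal.ofReal (‖u‖ ^ c) := by
  rw [← ofReal_norm, ENNReal.ofReal_rpow_of_pos (norm_pos_iff.2 hu)]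

theorem ae_ne_zero {d : ℕ} (hd : 0 < d) : ∀ᵐ u : E d, u ≠ 0 := by
  have : Nonempty (Fin d) := ⟨⟨0, hd⟩⟩
  exact Measure.ae_ne volume 0

/-- The value of `∫ |u|^c exp(-|u|²) du` over `ℝᵈ`. -/
def gaussMoment (d : ℕ) (c : ℝ) : ℝ :=
  Real.pi ^ ((d : ℝ) / 2) * Real.Gamma ((d + c) / 2) / Real.Gamma ((d : ℝ) / 2)

theorem gaussMoment_pos {d : ℕ} (hd : 0 < d) {c : ℝ} (hc : 0 < d + c) : 0 < gaussMoment d c := by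
  have : (0 : ℝ) < d := by exact_mod_cast hd
  exact div_pos (mul_pos (Real.rpow_pos_of_pos Real.pi_pos _)
    (Real.Gamma_pos_of_pos (by positivity))) (Real.Gamma_pos_of_pos (by positivity))

theorem lintegral_enorm_rpow_mul_exp {d : ℕ} (hd : 0 < d) {c : ℝ} (hc : 0 < d + c) {b : ℝ}
    (hb : 0 < b) : ∫⁻ u : E d, ‖u‖ₑ ^ c * ENNReal.ofReal (Real.exp (-b * ‖u‖ ^ 2)) =
      ENNReal.ofReal b ^ (-(d + c) / 2) * ENNReal.ofReal (gaussMoment d c) := by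
  have hd' : (1 : ℝ) ≤ d := by exact_mod_cast hd
  have h1 : ∫⁻ u : E d, ‖u‖ₑ ^ c * ENNReal.ofReal (Real.exp (-b * ‖u‖ ^ 2)) =
      ∫⁻ u : E d, ENNReal.ofReal ((fun r : ℝ => r ^ c * Real.exp (-b * r ^ (2 : ℝ))) ‖u‖) := by
    refine lintegral_congr_ae ?_
    filter_upwards [ae_ne_zero hd] with u hu
    rw [enorm_rpow_eq_ofReal hu, ← ENNReal.ofReal_mul (by positivity), Real.rpow_two]
  have h2 : ∀ r ∈ Set.Ioi (0 : ℝ), r ^ (d - 1) * (r ^ c * Real.exp (-b * r ^ (2 : ℝ))) =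
      r ^ ((d : ℝ) + c - 1) * Real.exp (-b * r ^ (2 : ℝ)) := by
    intro r hr
    rw [← mul_assoc, ← Real.rpow_natCast, ← Real.rpow_add hr, Nat.cast_sub hd, Nat.cast_one]
    congr 2
    ring
  have h3 := integral_rpow_mul_exp_neg_mul_rpow (p := 2) (q := (d : ℝ) + c - 1) two_pos
    (by linarith) hb
  rw [sub_add_cancel] at h3
  have hG : 0 < Real.Gamma ((d + c) / 2) := Real.Gamma_pos_of_pos (by positivity)
  have hG' : 0 < Real.Gamma ((d : ℝ) / 2) := Real.Gamma_pos_of_pos (by positivity)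
  have hint : IntegrableOn (fun r : ℝ => r ^ (d - 1) * (r ^ c * Real.exp (-b * r ^ (2 : ℝ))))
      (Set.Ioi 0) := by
    refine (integrableOn_congr_fun h2 measurableSet_Ioi).2 ?_
    -- A Bochner integral is zero by convention when the integrand is not integrable, so the nonzero
    -- value of `h3` already proves integrability.
    refine Integrable.of_integral_ne_zero ?_
    rw [h3]
    positivity
  rw [h1, lintegral_radial hd _ (fun r hr => by positivity) hint,
    setIntegral_congr_fun measurableSet_Ioi h2, h3, ENNReal.ofReal_rpow_of_pos hb,
    ← ENNReal.ofReal_mul (by positivity)]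
  congr 1
  rw [sphereArea, gaussMoment]
  field_simp

theorem lintegral_exp_neg_mul_sq {d : ℕ} (hd : 0 < d) {b : ℝ} (hb : 0 < b) :
    ∫⁻ u : E d, ENNReal.ofReal (Real.exp (-b * ‖u‖ ^ 2)) =
      ENNReal.ofReal b ^ (-(d : ℝ) / 2) * ENNReal.ofReal (Real.pi ^ ((d : ℝ) / 2)) := by
  have hd' : (0 : ℝ) < d := by exact_mod_cast hd
  have h := lintegral_enorm_rpow_mul_exp hd (c := 0) (by simpa using hd') hb
  have hG' : 0 < Real.Gamma ((d : ℝ) / 2) := Real.Gamma_pos_of_pos (by positivity)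
  simpa [gaussMoment, hG'.ne'] using h

theorem lintegral_ball_enorm_rpow {d : ℕ} (hd : 0 < d) {δ : ℝ} (hδ : 0 < δ) :
    ∫⁻ u : E d in Metric.ball 0 1, ‖u‖ₑ ^ (δ - d) = ENNReal.ofReal (sphereArea d / δ) := by
  have h1 : ∫⁻ u : E d in Metric.ball 0 1, ‖u‖ₑ ^ (δ - d) =
      ∫⁻ u : E d, ENNReal.ofReal ((Set.Iio (1 : ℝ)).indicator (fun r => r ^ (δ - d)) ‖u‖) := by
    rw [← lintegral_indicator measurableSet_ball]
    refine lintegral_congr_ae ?_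
    filter_upwards [ae_ne_zero hd] with u hu
    by_cases h : ‖u‖ < 1
    · rw [Set.indicator_of_mem (by simpa using h), Set.indicator_of_mem (by simpa using h),
        enorm_rpow_eq_ofReal hu]
    · rw [Set.indicator_of_notMem (by simpa using h), Set.indicator_of_notMem (by simpa using h),
        ENNReal.ofReal_zero]
  have h2 : ∀ r ∈ Set.Ioi (0 : ℝ), r ^ (d - 1) * (Set.Iio (1 : ℝ)).indicator
      (fun r => r ^ (δ - d)) r = (Set.Ioo (0 : ℝ) 1).indicator (fun r => r ^ (δ - 1)) r := by
    intro r hr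
    have hr' : (0 : ℝ) < r := hr
    by_cases h : r < 1
    · rw [Set.indicator_of_mem (by simpa using h), Set.indicator_of_mem (Set.mem_Ioo.2 ⟨hr', h⟩),
        ← Real.rpow_natCast, ← Real.rpow_add hr', Nat.cast_sub hd, Nat.cast_one]
      congr 1
      ring
    · rw [Set.indicator_of_notMem (by simpa using h),
        Set.indicator_of_notMem (fun h' => h h'.2), mul_zero]
  have hsub : Set.Ioo (0 : ℝ) 1 ⊆ Set.Ioi 0 := fun r hr => hr.1
  have hi : IntervalIntegrable (fun r : ℝ => r ^ (δ - 1)) volume 0 1 :=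
    intervalIntegral.intervalIntegrable_rpow' (by linarith)
  have hio : IntegrableOn (fun r : ℝ => r ^ (δ - 1)) (Set.Ioo 0 1) :=
    ((intervalIntegrable_iff_integrableOn_Ioc_of_le zero_le_one).1 hi).mono_set
      Set.Ioo_subset_Ioc_self
  have hval : ∫ r in Set.Ioi (0 : ℝ), (Set.Ioo (0 : ℝ) 1).indicator (fun r => r ^ (δ - 1)) r
      = 1 / δ := by
    rw [setIntegral_indicator measurableSet_Ioo, Set.inter_eq_right.2 hsub,
      ← integral_Ioc_eq_integral_Ioo, ← intervalIntegral.integral_of_le zero_le_one,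
      integral_rpow (Or.inl (by linarith))]
    simp [hδ.ne']
  rw [h1, lintegral_radial hd _ ?_ ?_, setIntegral_congr_fun measurableSet_Ioi h2, hval,
    mul_one_div]
  · intro r hr
    rw [Set.indicator_apply]
    split_ifs
    exacts [Real.rpow_nonneg hr _, le_rfl]
  · refine (integrableOn_congr_fun h2 measurableSet_Ioi).2 ?_
    exact (hio.integrable_indicator measurableSet_Ioo).integrableOn

/-- The value of the integral of `(1 + |z|²)^{-(m + d - a)/2}` over `ℝᵐ`. -/
theorem lintegral_add_sq_rpow {m d : ℕ} (hm : 0 < m) (hd : 0 < d) {a : ℝ} (ha : a < d) {r : ℝ}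
    (hr : 0 < r) : ∫⁻ z : E m, ENNReal.ofReal (r ^ 2 + ‖z‖ ^ 2) ^ (-((d : ℝ) + (m - a)) / 2) =
      ENNReal.ofReal (Real.pi ^ ((m : ℝ) / 2) * Real.Gamma ((d - a) / 2) /
        Real.Gamma ((d + m - a) / 2)) * ENNReal.ofReal r ^ (a - d) := by
  have hm' : (0 : ℝ) < m := by exact_mod_cast hm
  have hd' : (0 : ℝ) < d := by exact_mod_cast hd
  have hI := gaussMoment_pos hd (c := m - a) (by linarith)
  have hI' := gaussMoment_pos hd (c := -a) (by linarith)
  -- The power of r² + |z|² is written as a Gaussian moment over an auxiliary ℝᵈ. After Tonelli the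
  -- Gaussian in z integrates out, leaving a Gaussian moment of lower exponent.
  have e1 : ∀ z : E m, ∫⁻ u : E d, ‖u‖ₑ ^ ((m : ℝ) - a) *
      ENNReal.ofReal (Real.exp (-(r ^ 2 + ‖z‖ ^ 2) * ‖u‖ ^ 2)) =
      ENNReal.ofReal (r ^ 2 + ‖z‖ ^ 2) ^ (-((d : ℝ) + (m - a)) / 2) *
        ENNReal.ofReal (gaussMoment d (m - a)) := fun z =>
    lintegral_enorm_rpow_mul_exp hd (by linarith) (by positivity)
  have e2 : ∀ u : E d, u ≠ 0 → ∫⁻ z : E m, ‖u‖ₑ ^ ((m : ℝ) - a) *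
      ENNReal.ofReal (Real.exp (-(r ^ 2 + ‖z‖ ^ 2) * ‖u‖ ^ 2)) =
      ENNReal.ofReal (Real.pi ^ ((m : ℝ) / 2)) *
        (‖u‖ₑ ^ (-a) * ENNReal.ofReal (Real.exp (-(r ^ 2) * ‖u‖ ^ 2))) := by
    intro u hu
    have hu' : 0 < ‖u‖ := norm_pos_iff.2 hu
    have h : ∀ z : E m, ‖u‖ₑ ^ ((m : ℝ) - a) *
        ENNReal.ofReal (Real.exp (-(r ^ 2 + ‖z‖ ^ 2) * ‖u‖ ^ 2)) =
        (‖u‖ₑ ^ ((m : ℝ) - a) * ENNReal.ofReal (Real.exp (-(r ^ 2) * ‖u‖ ^ 2))) *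
          ENNReal.ofReal (Real.exp (-(‖u‖ ^ 2) * ‖z‖ ^ 2)) := by
      intro z
      rw [mul_assoc, ← ENNReal.ofReal_mul (Real.exp_pos _).le, ← Real.exp_add]
      congr 3
      ring
    simp_rw [h]
    rw [lintegral_const_mul _ (by fun_prop), lintegral_exp_neg_mul_sq hm (by positivity)]
    have h3 : ENNReal.ofReal (‖u‖ ^ 2) ^ (-(m : ℝ) / 2) = ‖u‖ₑ ^ (-(m : ℝ)) := by
      rw [ENNReal.ofReal_pow (norm_nonneg _), ofReal_norm, ← ENNReal.rpow_natCast,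
        ← ENNReal.rpow_mul]
      congr 1
      push_cast
      ring
    have h4 : ‖u‖ₑ ^ (-a) = ‖u‖ₑ ^ ((m : ℝ) - a) * ‖u‖ₑ ^ (-(m : ℝ)) := by
      rw [← ENNReal.rpow_add _ _ (by simpa using hu) (by simp)]
      congr 1
      ring
    rw [h3, h4]
    ring
  have hswap : ∫⁻ z : E m, ∫⁻ u : E d, ‖u‖ₑ ^ ((m : ℝ) - a) *
      ENNReal.ofReal (Real.exp (-(r ^ 2 + ‖z‖ ^ 2) * ‖u‖ ^ 2)) =
      ∫⁻ u : E d, ∫⁻ z : E m, ‖u‖ₑ ^ ((m : ℝ) - a) *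
      ENNReal.ofReal (Real.exp (-(r ^ 2 + ‖z‖ ^ 2) * ‖u‖ ^ 2)) :=
    lintegral_lintegral_swap (by fun_prop)
  simp_rw [e1] at hswap
  rw [lintegral_mul_const _ (by fun_prop), lintegral_congr_ae ((ae_ne_zero hd).mono e2),
    lintegral_const_mul _ (by fun_prop), lintegral_enorm_rpow_mul_exp hd (by linarith)
    (by positivity)] at hswap
  have h5 : ENNReal.ofReal (r ^ 2) ^ (-((d : ℝ) + -a) / 2) = ENNReal.ofReal r ^ (a - d) := by
    rw [ENNReal.ofReal_pow hr.le, ← ENNReal.rpow_natCast, ← ENNReal.rpow_mul]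
    congr 1
    push_cast
    ring
  rw [h5] at hswap
  have h6 : ENNReal.ofReal (Real.pi ^ ((m : ℝ) / 2) * Real.Gamma ((d - a) / 2) /
        Real.Gamma ((d + m - a) / 2)) * ENNReal.ofReal (gaussMoment d (m - a)) =
      ENNReal.ofReal (Real.pi ^ ((m : ℝ) / 2)) * ENNReal.ofReal (gaussMoment d (-a)) := by
    have g1 := Real.Gamma_pos_of_pos (s := ((d : ℝ) - a) / 2) (by linarith)
    have g2 := Real.Gamma_pos_of_pos (s := ((d : ℝ) + m - a) / 2) (by linarith)
    have g3 := Real.Gamma_pos_of_pos (s := (d : ℝ) / 2) (by linarith)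
    rw [← ENNReal.ofReal_mul (by positivity), ← ENNReal.ofReal_mul (by positivity)]
    congr 1
    rw [gaussMoment, gaussMoment, ← sub_eq_add_neg, ← add_sub_assoc]
    field_simp
  refine (ENNReal.mul_left_inj (c := ENNReal.ofReal (gaussMoment d (m - a)))
    (by simpa using hI) ENNReal.ofReal_ne_top).1 ?_
  rw [hswap, mul_right_comm, h6]
  ring

/-! ### Invariance of the measures -/

section Haar

variable (G : Type*) [Group G] [TopologicalSpace G] [IsTopologicalGroup G] [CompactSpace G]
  [MeasurableSpace G] [BorelSpace G]

instance : (probHaar G).IsHaarMeasure :=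
  inferInstanceAs (Measure.haarMeasure (⊤ : TopologicalSpace.PositiveCompacts G)).IsHaarMeasure

instance : IsProbabilityMeasure (probHaar G) :=
  ⟨by
    have h := Measure.haarMeasure_self (K₀ := (⊤ : TopologicalSpace.PositiveCompacts G))
    rwa [TopologicalSpace.PositiveCompacts.coe_top] at h⟩

/-- Compact groups are unimodular: a right translate of the Haar probability measure is again a Haar
probability measure, and there is only one. -/
theorem measurePreserving_mul_right_probHaar (g : G) :
    MeasurePreserving (fun x => x * g) (probHaar G) (probHaar G) := by
  have hm : Measurable fun x : G => x * g := (continuous_mul_const g).measurable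
  refine ⟨hm, ?_⟩
  have : IsProbabilityMeasure (Measure.map (fun x => x * g) (probHaar G)) :=
    Measure.isProbabilityMeasure_map hm.aemeasurable
  exact Measure.isHaarMeasure_eq_of_isProbabilityMeasure _ _

end Haar

instance (n : ℕ) : SecondCountableTopology (O n) :=
  have : SecondCountableTopology (Matrix (Fin n) (Fin n) ℝ) :=
    inferInstanceAs (SecondCountableTopology (Fin n → Fin n → ℝ))
  TopologicalSpace.Subtype.secondCountableTopology _

instance (n j : ℕ) : SecondCountableTopology (fixSubgroup n j) :=
  TopologicalSpace.Subtype.secondCountableTopology _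

/-! ### The splitting `ℝⁿ⁻ʲ = ℝᵏ⁻ʲ ⊕ ℝⁿ⁻ᵏ` -/

/-- The bijection of coordinates in `ℝᵏ⁻ʲ ⊕ ℝⁿ⁻ᵏ = ℝⁿ⁻ʲ`. -/
def splitIndex {n j k : ℕ} (hjk : j ≤ k) (hk : k ≤ n) :
    Fin (k - j) ⊕ Fin (n - k) ≃ Fin (n - j) :=
  finSumFinEquiv.trans (finCongr (by omega))

/-- The isometry `ℝᵏ⁻ʲ ⊕ ℝⁿ⁻ᵏ = ℝⁿ⁻ʲ`. -/
def splitIsometry {n j k : ℕ} (hjk : j ≤ k) (hk : k ≤ n) :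
    WithLp 2 (E (k - j) × E (n - k)) ≃ₗᵢ[ℝ] E (n - j) :=
  LinearIsometry.toLinearIsometryEquiv
    { toFun := fun x => WithLp.toLp 2 fun i => Sum.elim x.fst x.snd ((splitIndex hjk hk).symm i)
      map_add' := fun x y => by
        ext i
        rcases h : (splitIndex hjk hk).symm i with l | l <;> simp [h]
      map_smul' := fun c x => by
        ext i
        rcases h : (splitIndex hjk hk).symm i with l | l <;> simp [h]
      norm_map' := fun x => by
        refine (sq_eq_sq₀ (norm_nonneg _) (norm_nonneg _)).1 ?_
        rw [WithLp.prod_norm_sq_eq_of_L2, EuclideanSpace.real_norm_sq_eq,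
          EuclideanSpace.real_norm_sq_eq, EuclideanSpace.real_norm_sq_eq]
        change ∑ i, (Sum.elim x.fst x.snd ((splitIndex hjk hk).symm i)) ^ 2 = _
        rw [(splitIndex hjk hk).symm.sum_comp (fun s => (Sum.elim x.fst x.snd s) ^ 2),
          Fintype.sum_sum_type]
        rfl }
    (by
      rw [(WithLp.linearEquiv 2 ℝ (E (k - j) × E (n - k))).finrank_eq]
      simp
      omega)

/-- The vector of `ℝⁿ⁻ʲ` with components `z ∈ ℝᵏ⁻ʲ` and `u ∈ ℝⁿ⁻ᵏ`. -/
def join {n j k : ℕ} (hjk : j ≤ k) (hk : k ≤ n) (x : E (k - j) × E (n - k)) : E (n - j) :=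
  splitIsometry hjk hk (WithLp.toLp 2 x)

theorem measurePreserving_join {n j k : ℕ} (hjk : j ≤ k) (hk : k ≤ n) :
    MeasurePreserving (join (n := n) hjk hk) :=
  (splitIsometry hjk hk).measurePreserving.comp (WithLp.volume_preserving_toLp _ _)

theorem norm_join {n j k : ℕ} (hjk : j ≤ k) (hk : k ≤ n) (x : E (k - j) × E (n - k)) :
    ‖join hjk hk x‖ = √(‖x.1‖ ^ 2 + ‖x.2‖ ^ 2) := by
  rw [join, LinearIsometryEquiv.norm_map, WithLp.prod_norm_eq_of_L2]
  rfl

theorem compTail_join {n j k : ℕ} (hjk : j ≤ k) (hk : k ≤ n) (x : E (k - j) × E (n - k)) :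
    compTail n j k (join hjk hk x) = x.2 := by
  ext i
  have h : (⟨i.val + k - j, by omega⟩ : Fin (n - j)) = splitIndex hjk hk (Sum.inr i) := by
    apply Fin.ext
    simp [splitIndex]
    omega
  have hj : j ≤ i.val + k := by omega
  simp only [compTail_apply, tailProj_apply, coordCompl, hj, dif_pos, h]
  change Sum.elim x.1 x.2 ((splitIndex hjk hk).symm (splitIndex hjk hk (Sum.inr i))) = _
  rw [Equiv.symm_apply_apply]
  rfl

/-! ### The planes through a plane, in coordinates -/

/-- The parameters of the `k`-plane `g ρ ℝᵏ + g y`. -/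
def paramThrough {n j : ℕ} (k : ℕ) (q : O n × E (n - j)) (ρ : fixSubgroup n j) :
    O n × E (n - k) :=
  (q.1 * ρ.1, compTail n j k (actCompl ρ⁻¹ q.2))

theorem continuous_rot {n : ℕ} {X : Type*} [TopologicalSpace X] {f : X → O n} {v : X → E n}
    (hf : Continuous f) (hv : Continuous v) : Continuous fun x => rot (f x) (v x) := by
  simp only [rot_apply]
  refine (PiLp.continuous_toLp 2 _).comp ?_
  exact Continuous.matrix_mulVec (continuous_subtype_val.comp hf)
    ((PiLp.continuous_ofLp 2 _).comp hv)

theorem continuous_actCompl {n j : ℕ} :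
    Continuous fun q : fixSubgroup n j × E (n - j) => actCompl q.1 q.2 := by
  have h1 : Continuous (tailProj (n := n) j) := (tailProj j).continuous_of_finiteDimensional
  have h2 : Continuous (coordComplₗ (n := n) j) := (coordComplₗ j).continuous_of_finiteDimensional
  have h3 : Continuous fun q : fixSubgroup n j × E (n - j) =>
      rot q.1.1 (coordComplₗ (n := n) j q.2) :=
    continuous_rot (continuous_subtype_val.comp continuous_fst) (h2.comp continuous_snd)
  exact h1.comp h3

theorem continuous_paramThrough {n j k : ℕ} :
    Continuous fun x : (O n × E (n - j)) × fixSubgroup n j => paramThrough k x.1 x.2 := by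
  have h1 : Continuous fun x : (O n × E (n - j)) × fixSubgroup n j => x.1.1 * x.2.1 :=
    (continuous_fst.comp continuous_fst).mul (continuous_subtype_val.comp continuous_snd)
  have h2 : Continuous fun x : (O n × E (n - j)) × fixSubgroup n j => actCompl x.2⁻¹ x.1.2 :=
    continuous_actCompl.comp (f := fun x : (O n × E (n - j)) × fixSubgroup n j => (x.2⁻¹, x.1.2))
      ((continuous_inv.comp continuous_snd).prodMk (continuous_snd.comp continuous_fst))
  have h3 : Continuous (compTail n j k) := (compTail n j k).continuous_of_finiteDimensional
  have h4 : Continuous fun x : (O n × E (n - j)) × fixSubgroup n j =>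
      compTail n j k (actCompl x.2⁻¹ x.1.2) := h3.comp h2
  exact h1.prodMk h4

/-! ### Measurability and the incidence formula -/

theorem measurable_param {n k : ℕ} (h : k ≤ n) : Measurable (param h) := fun _ hs => hs

theorem measurable_of_comp_param {n k : ℕ} {h : k ≤ n} {β : Type*} [MeasurableSpace β]
    {f : AffPlane h → β} (hf : Measurable fun q => f (param h q)) : Measurable f :=
  fun _ hs => hf hs

theorem measurable_dist {n k : ℕ} {h : k ≤ n} :
    Measurable fun τ : AffPlane h => τ.dist := by
  refine measurable_of_comp_param ?_
  simp only [dist_param]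
  fun_prop

theorem lintegral_planeMeasure {n k : ℕ} {h : k ≤ n} {f : AffPlane h → ℝ≥0∞}
    (hf : Measurable f) : ∫⁻ τ, f τ ∂(planeMeasure h) =
      ∫⁻ q, f (param h q) ∂((probHaar (O n)).prod volume) :=
  lintegral_map hf (measurable_param h)

theorem lintegral_join {n j k : ℕ} (hjk : j ≤ k) (hk : k ≤ n) {f : E (n - j) → ℝ≥0∞}
    (hf : Measurable f) :
    ∫⁻ y, f y = ∫⁻ u : E (n - k), ∫⁻ z : E (k - j), f (join hjk hk (z, u)) := by
  have h := (measurePreserving_join hjk hk).lintegral_comp hf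
  rw [← h, Measure.volume_eq_prod]
  exact lintegral_prod_symm _ (hf.comp (measurePreserving_join hjk hk).measurable).aemeasurable

theorem lintegral_mul_actCompl {n j : ℕ} (ρ : fixSubgroup n j) {f : O n × E (n - j) → ℝ≥0∞}
    (hf : Measurable f) :
    ∫⁻ q, f (q.1 * ρ.1, actCompl ρ⁻¹ q.2) ∂((probHaar (O n)).prod volume) =
      ∫⁻ q, f q ∂((probHaar (O n)).prod volume) :=
  ((measurePreserving_mul_right_probHaar (O n) ρ.1).prod
    (actCompl ρ⁻¹).measurePreserving).lintegral_comp hf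

/-- The measure on incident pairs ζ ⊂ τ, disintegrated in two ways. For fixed ρ the substitution (g,
y) ↦ (gρ, ρ⁻¹y) preserves the measure and |y|, so the average over ρ drops out. Splitting y into z ∈
ℝᵏ⁻ʲ and u ∈ ℝⁿ⁻ᵏ then makes (g, u) the parameters of τ and z the position of ζ inside it. The first
slot of F carries |ζ|. -/
theorem lintegral_paramThrough {n j k : ℕ} (hjk : j ≤ k) (hk : k ≤ n)
    {F : ℝ × (O n × E (n - k)) → ℝ≥0∞} (hF : Measurable F) :
    ∫⁻ q, ∫⁻ ρ, F (‖q.2‖, paramThrough k q ρ) ∂(probHaar (fixSubgroup n j))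
        ∂((probHaar (O n)).prod (volume : Measure (E (n - j)))) =
      ∫⁻ q, (∫⁻ z : E (k - j), F (√(‖z‖ ^ 2 + ‖q.2‖ ^ 2), q))
        ∂((probHaar (O n)).prod (volume : Measure (E (n - k)))) := by
  have hct : Measurable (compTail n j k) :=
    (compTail n j k).continuous_of_finiteDimensional.measurable
  have hFp : Measurable fun x : (O n × E (n - j)) × fixSubgroup n j =>
      F (‖x.1.2‖, paramThrough k x.1 x.2) := by
    have h := (continuous_paramThrough (n := n) (j := j) (k := k)).measurable
    have h' : Measurable fun x : (O n × E (n - j)) × fixSubgroup n j => ‖x.1.2‖ :=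
      measurable_norm.comp (measurable_snd.comp measurable_fst)
    exact hF.comp (h'.prodMk h)
  have hFm : Measurable fun q : O n × E (n - j) => F (‖q.2‖, (q.1, compTail n j k q.2)) := by
    have h' : Measurable fun q : O n × E (n - j) => ‖q.2‖ := measurable_norm.comp measurable_snd
    exact hF.comp (h'.prodMk (measurable_fst.prodMk (hct.comp measurable_snd)))
  have hFm' : Measurable fun x : (O n × E (n - k)) × E (k - j) =>
      F (√(‖x.2‖ ^ 2 + ‖x.1.2‖ ^ 2), x.1) := by
    have h' : Measurable fun x : (O n × E (n - k)) × E (k - j) => √(‖x.2‖ ^ 2 + ‖x.1.2‖ ^ 2) := by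
      fun_prop
    exact hF.comp (h'.prodMk measurable_fst)
  have h1 : ∀ ρ : fixSubgroup n j,
      ∫⁻ q, F (‖q.2‖, paramThrough k q ρ) ∂((probHaar (O n)).prod (volume : Measure (E (n - j)))) =
      ∫⁻ q, F (‖q.2‖, (q.1, compTail n j k q.2))
        ∂((probHaar (O n)).prod (volume : Measure (E (n - j)))) := by
    intro ρ
    rw [← lintegral_mul_actCompl ρ hFm]
    simp only [LinearIsometryEquiv.norm_map, paramThrough]
  refine (lintegral_lintegral_swap hFp.aemeasurable).trans ?_
  refine (lintegral_congr h1).trans ?_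
  rw [lintegral_const, measure_univ, mul_one]
  refine (lintegral_prod _ hFm.aemeasurable).trans (Eq.trans ?_
    (lintegral_prod _ hFm'.lintegral_prod_right'.aemeasurable).symm)
  have hg : ∀ g : O n, ∫⁻ y : E (n - j), F (‖y‖, (g, compTail n j k y)) =
      ∫⁻ u : E (n - k), ∫⁻ z : E (k - j), F (√(‖z‖ ^ 2 + ‖u‖ ^ 2), (g, u)) := by
    intro g
    have hmk : Measurable fun y : E (n - j) => (g, y) := measurable_prodMk_left
    have hFg : Measurable fun y : E (n - j) => F (‖y‖, (g, compTail n j k y)) :=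
      (hFm.comp hmk :)
    refine (lintegral_join hjk hk hFg).trans ?_
    simp only [norm_join, compTail_join]
  exact lintegral_congr hg

/-! ### The transform of nonnegative functions -/

/-- The dual transform of a `[0, ∞]`-valued function. -/
def lowerDual {n j k : ℕ} {hj : j ≤ n} {hk : k ≤ n} (G : AffPlane hk → ℝ≥0∞)
    (ζ : AffPlane hj) : ℝ≥0∞ :=
  ∫⁻ ρ, G (planeThrough hk ζ ρ) ∂(probHaar (fixSubgroup n j))

/-- Left invariance of the measure on O(n - j) absorbs the rotation β between the chosen frame and
g. The transform therefore does not depend on the choice in `coords`. -/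
theorem lowerDual_param {n j k : ℕ} (hjk : j ≤ k) {hj : j ≤ n} {hk : k ≤ n}
    (G : AffPlane hk → ℝ≥0∞) (q : O n × E (n - j)) :
    lowerDual G (param hj q) =
      ∫⁻ ρ, G (param hk (paramThrough k q ρ)) ∂(probHaar (fixSubgroup n j)) := by
  obtain ⟨β, hβ⟩ := exists_planeThrough_param hjk hj hk q.1 q.2
  rw [← lintegral_mul_left_eq_self _ β]
  exact lintegral_congr fun ρ => congrArg G (hβ ρ)

theorem dualTransform_param {𝕜 : Type*} [RCLike 𝕜] {n j k : ℕ} (hjk : j ≤ k) {hj : j ≤ n}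
    {hk : k ≤ n} (φ : AffPlane hk → 𝕜) (q : O n × E (n - j)) :
    dualTransform φ (param hj q) =
      ∫ ρ, φ (param hk (paramThrough k q ρ)) ∂(probHaar (fixSubgroup n j)) := by
  obtain ⟨β, hβ⟩ := exists_planeThrough_param hjk hj hk q.1 q.2
  rw [← integral_mul_left_eq_self _ β]
  exact integral_congr_ae (.of_forall fun ρ => congrArg φ (hβ ρ))

theorem measurable_planeThrough {n j k : ℕ} (hjk : j ≤ k) {hj : j ≤ n} {hk : k ≤ n}
    (ζ : AffPlane hj) : Measurable fun ρ : fixSubgroup n j => planeThrough hk ζ ρ := by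
  obtain ⟨β, hβ⟩ := exists_planeThrough_param hjk hj hk (coords ζ).1 (coords ζ).2
  have h : (fun ρ : fixSubgroup n j => planeThrough hk ζ ρ) =
      fun ρ => param hk (paramThrough k (coords ζ) (β * ρ)) := by
    funext ρ
    exact (congrArg (fun ζ => planeThrough hk ζ ρ) (param_coords ζ).symm).trans (hβ ρ)
  rw [h]
  refine (measurable_param hk).comp ?_
  exact (continuous_paramThrough.comp
    (continuous_const.prodMk (continuous_const_mul β))).measurable

theorem measurable_param_paramThrough {n j k : ℕ} (hk : k ≤ n) :
    Measurable fun x : (O n × E (n - j)) × fixSubgroup n j => param hk (paramThrough k x.1 x.2) :=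
  (measurable_param hk).comp continuous_paramThrough.measurable

/-- The frame chosen for ζ need not be measurable in ζ; the formula in the parameters (g, y) avoids
it and is jointly measurable. -/
theorem measurable_lowerDual {n j k : ℕ} (hjk : j ≤ k) {hj : j ≤ n} {hk : k ≤ n}
    {G : AffPlane hk → ℝ≥0∞} (hG : Measurable G) :
    Measurable (lowerDual G : AffPlane hj → ℝ≥0∞) := by
  refine measurable_of_comp_param ?_
  simp only [lowerDual_param hjk]
  exact (hG.comp (measurable_param_paramThrough hk)).lintegral_prod_right'

theorem measurable_dualTransform {𝕜 : Type*} [RCLike 𝕜] {n j k : ℕ} (hjk : j ≤ k) {hj : j ≤ n}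
    {hk : k ≤ n} {φ : AffPlane hk → 𝕜} (hφ : Measurable φ) :
    Measurable (dualTransform φ : AffPlane hj → 𝕜) := by
  refine measurable_of_comp_param ?_
  simp only [dualTransform_param hjk]
  exact (hφ.comp (measurable_param_paramThrough hk)).stronglyMeasurable.integral_prod_right'.measurable

/-- For almost every `j`-plane, almost every `k`-plane through it avoids a given null set. -/
theorem ae_ae_planeThrough {n j k : ℕ} (hjk : j ≤ k) {hj : j ≤ n} {hk : k ≤ n}
    {P : AffPlane hk → Prop} (hP : ∀ᵐ τ ∂(planeMeasure hk), P τ) :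
    ∀ᵐ ζ ∂(planeMeasure hj), ∀ᵐ ρ ∂(probHaar (fixSubgroup n j)), P (planeThrough hk ζ ρ) := by
  obtain ⟨N, hPN, hN, hN0⟩ := exists_measurable_superset_of_null (ae_iff.1 hP)
  let G : AffPlane hk → ℝ≥0∞ := N.indicator 1
  have hG : Measurable G := measurable_one.indicator hN
  have hGm : Measurable fun q => G (param hk q) := hG.comp (measurable_param hk)
  have h0 : ∫⁻ ζ, lowerDual G ζ ∂(planeMeasure hj) = 0 := by
    rw [lintegral_planeMeasure (measurable_lowerDual hjk hG)]
    simp only [lowerDual_param hjk]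
    -- Here F ignores the distance, so the inner integral is over all of ℝᵏ⁻ʲ, which has infinite
    -- volume; this does no harm because G vanishes almost everywhere.
    rw [lintegral_paramThrough hjk hk (F := fun x => G (param hk x.2))
      (hGm.comp measurable_snd)]
    have h1 : ∫⁻ q, G (param hk q) ∂((probHaar (O n)).prod volume) = 0 := by
      rw [← lintegral_planeMeasure hG, lintegral_indicator_one hN, hN0]
    have h2 := (lintegral_eq_zero_iff hGm).1 h1
    rw [lintegral_congr_ae (g := fun _ => 0), lintegral_zero]
    filter_upwards [h2] with q hq
    have hq' : G (param hk q) = 0 := hq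
    simp [hq']
  filter_upwards [(lintegral_eq_zero_iff (measurable_lowerDual hjk hG)).1 h0] with ζ hζ
  filter_upwards [(lintegral_eq_zero_iff (hG.comp (measurable_planeThrough hjk ζ))).1 hζ] with ρ hρ
  by_contra hn
  have : planeThrough hk ζ ρ ∈ N := hPN hn
  simp [G, this] at hρ

theorem ae_dist_pos {n k : ℕ} {h : k ≤ n} (hkn : k < n) :
    ∀ᵐ τ ∂(planeMeasure h), 0 < τ.dist := by
  refine (ae_map_iff (measurable_param h).aemeasurable
    (measurableSet_lt measurable_const measurable_dist)).2 ?_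
  have h1 : ∀ᵐ y : E (n - k), y ≠ 0 := ae_ne_zero (by omega)
  have h2 : ∀ᵐ q : O n × E (n - k) ∂((probHaar (O n)).prod volume), q.2 ≠ 0 :=
    Measure.quasiMeasurePreserving_snd.ae h1
  filter_upwards [h2] with q hq
  rw [dist_param]
  exact norm_pos_iff.2 hq

/-! ### Moments of the distance of a random plane -/

/-- The mean value of `|τ|^{-a}` over the `k`-planes `τ` through a `j`-plane at distance one from
the origin, with `d = n - j` and `d' = n - k`. -/
def momentConst (d d' : ℕ) (a : ℝ) : ℝ :=
  Real.Gamma ((d : ℝ) / 2) * Real.Gamma ((d' - a) / 2) /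
    (Real.Gamma ((d' : ℝ) / 2) * Real.Gamma ((d - a) / 2))

theorem momentConst_pos {d d' : ℕ} (hd' : 0 < d') (hd : d' ≤ d) {a : ℝ} (ha : a < d') :
    0 < momentConst d d' a := by
  have h1 : (0 : ℝ) < d' := by exact_mod_cast hd'
  have h2 : (d' : ℝ) ≤ d := by exact_mod_cast hd
  exact div_pos (mul_pos (Real.Gamma_pos_of_pos (by linarith)) (Real.Gamma_pos_of_pos (by linarith)))
    (mul_pos (Real.Gamma_pos_of_pos (by linarith)) (Real.Gamma_pos_of_pos (by linarith)))

theorem measurable_compTail {n j k : ℕ} : Measurable (compTail n j k) :=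
  (compTail n j k).continuous_of_finiteDimensional.measurable

theorem lintegral_exp_mul_enorm_compTail {n j k : ℕ} (hjk : j < k) (hk : k < n) {a : ℝ}
    (ha : a < (n - k : ℕ)) :
    ∫⁻ y : E (n - j), ‖compTail n j k y‖ₑ ^ (-a) * ENNReal.ofReal (Real.exp (-1 * ‖y‖ ^ 2)) =
      ENNReal.ofReal (Real.pi ^ (((k - j : ℕ) : ℝ) / 2)) *
        ENNReal.ofReal (gaussMoment (n - k) (-a)) := by
  have hm : Measurable fun y : E (n - j) =>
      ‖compTail n j k y‖ₑ ^ (-a) * ENNReal.ofReal (Real.exp (-1 * ‖y‖ ^ 2)) := by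
    have h1 : Measurable fun y : E (n - j) => ‖compTail n j k y‖ₑ ^ (-a) :=
      (measurable_compTail.enorm.pow_const (-a) :)
    have h2 : Measurable fun y : E (n - j) => ENNReal.ofReal (Real.exp (-1 * ‖y‖ ^ 2)) := by
      fun_prop
    exact h1.mul h2
  refine (lintegral_join hjk.le hk.le hm).trans ?_
  simp only [norm_join, compTail_join]
  have h : ∀ u : E (n - k), ∫⁻ z : E (k - j), ‖u‖ₑ ^ (-a) *
      ENNReal.ofReal (Real.exp (-1 * √(‖z‖ ^ 2 + ‖u‖ ^ 2) ^ 2)) =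
      ENNReal.ofReal (Real.pi ^ (((k - j : ℕ) : ℝ) / 2)) *
        (‖u‖ₑ ^ (-a) * ENNReal.ofReal (Real.exp (-1 * ‖u‖ ^ 2))) := by
    intro u
    have h1 : ∀ z : E (k - j), ‖u‖ₑ ^ (-a) *
        ENNReal.ofReal (Real.exp (-1 * √(‖z‖ ^ 2 + ‖u‖ ^ 2) ^ 2)) =
        (‖u‖ₑ ^ (-a) * ENNReal.ofReal (Real.exp (-1 * ‖u‖ ^ 2))) *
          ENNReal.ofReal (Real.exp (-1 * ‖z‖ ^ 2)) := by
      intro z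
      rw [mul_assoc, ← ENNReal.ofReal_mul (Real.exp_pos _).le, ← Real.exp_add,
        Real.sq_sqrt (by positivity)]
      congr 3
      ring
    simp_rw [h1]
    rw [lintegral_const_mul _ (by fun_prop), lintegral_exp_neg_mul_sq (by omega) one_pos]
    simp [mul_comm]
  simp_rw [h]
  rw [lintegral_const_mul _ (by fun_prop),
    lintegral_enorm_rpow_mul_exp (by omega) (by linarith) one_pos]
  simp

/-- Two vectors of equal length differ by some γ ∈ O(n - j), and replacing ρ by γρ removes it. -/
theorem lintegral_enorm_compTail_eq {n j k : ℕ} (a : ℝ) {y y' : E (n - j)} (h : ‖y‖ = ‖y'‖) :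
    ∫⁻ ρ : fixSubgroup n j, ‖compTail n j k (actCompl ρ⁻¹ y)‖ₑ ^ (-a)
        ∂(probHaar (fixSubgroup n j)) =
      ∫⁻ ρ : fixSubgroup n j, ‖compTail n j k (actCompl ρ⁻¹ y')‖ₑ ^ (-a)
        ∂(probHaar (fixSubgroup n j)) := by
  obtain ⟨γ, rfl⟩ := exists_actCompl_eq h
  rw [← lintegral_mul_left_eq_self
    (fun ρ : fixSubgroup n j => ‖compTail n j k (actCompl ρ⁻¹ (actCompl γ y))‖ₑ ^ (-a)) γ]
  refine lintegral_congr fun ρ => ?_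
  rw [← actCompl_mul, mul_inv_rev, inv_mul_cancel_right]

/-- As a function of y the mean is rotation invariant and homogeneous of degree -a, hence a constant
times |y|^{-a}. Integrating it against exp(-|y|²), once in this form and once with the ρ-average
taken last, determines the constant. -/
theorem lintegral_enorm_compTail {n j k : ℕ} (hjk : j < k) (hk : k < n) {a : ℝ}
    (ha : a < (n - k : ℕ)) {y : E (n - j)} (hy : y ≠ 0) :
    ∫⁻ ρ : fixSubgroup n j, ‖compTail n j k (actCompl ρ⁻¹ y)‖ₑ ^ (-a)
        ∂(probHaar (fixSubgroup n j)) =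
      ENNReal.ofReal (momentConst (n - j) (n - k) a) * ‖y‖ₑ ^ (-a) := by
  have hd : 0 < n - j := by omega
  have hdd : ((n - k : ℕ) : ℝ) ≤ (n - j : ℕ) := by exact_mod_cast (by omega : n - k ≤ n - j)
  have hdm : ((n - j : ℕ) : ℝ) = (k - j : ℕ) + (n - k : ℕ) := by
    exact_mod_cast (by omega : n - j = (k - j) + (n - k))
  have hd1 : (0 : ℝ) < (n - k : ℕ) := by exact_mod_cast (by omega : 0 < n - k)
  let M : E (n - j) → ℝ≥0∞ := fun y =>
    ∫⁻ ρ : fixSubgroup n j, ‖compTail n j k (actCompl ρ⁻¹ y)‖ₑ ^ (-a) ∂(probHaar (fixSubgroup n j))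
  let e : E (n - j) := EuclideanSpace.single ⟨0, hd⟩ 1
  have he : ‖e‖ = 1 := by simp [e]
  have hmeas : Measurable fun x : E (n - j) × fixSubgroup n j =>
      ‖compTail n j k (actCompl x.2⁻¹ x.1)‖ₑ ^ (-a) := by
    have h1 : Continuous fun x : E (n - j) × fixSubgroup n j => (x.2⁻¹, x.1) :=
      (continuous_inv.comp continuous_snd).prodMk continuous_fst
    have h2 := (measurable_compTail (k := k)).comp (continuous_actCompl.comp h1).measurable
    exact (h2.enorm.pow_const (-a) :)
  have hM : ∀ y : E (n - j), y ≠ 0 → M y = M e * ‖y‖ₑ ^ (-a) := by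
    intro y hy
    have h1 : M y = M (‖y‖ • e) := lintegral_enorm_compTail_eq a (by
      rw [norm_smul, he, norm_norm, mul_one])
    have hy0 : ‖y‖ₑ ^ (-a) ≠ ∞ := by
      simp [ENNReal.rpow_eq_top_iff, hy]
    rw [h1]
    change ∫⁻ ρ : fixSubgroup n j, _ ∂_ = (∫⁻ ρ : fixSubgroup n j, _ ∂_) * _
    rw [← lintegral_mul_const' _ _ hy0]
    refine lintegral_congr fun ρ => ?_
    rw [map_smul, map_smul, enorm_smul, enorm_norm, ENNReal.mul_rpow_of_ne_top (by simp) (by simp),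
      mul_comm]
  have hexp : ∀ y : E (n - j), M y * ENNReal.ofReal (Real.exp (-1 * ‖y‖ ^ 2)) =
      ∫⁻ ρ : fixSubgroup n j, ‖compTail n j k (actCompl ρ⁻¹ y)‖ₑ ^ (-a) *
        ENNReal.ofReal (Real.exp (-1 * ‖actCompl ρ⁻¹ y‖ ^ 2)) ∂(probHaar (fixSubgroup n j)) := by
    intro y
    simp only [LinearIsometryEquiv.norm_map]
    rw [lintegral_mul_const' _ _ ENNReal.ofReal_ne_top]
  have hleft : ∫⁻ y, M y * ENNReal.ofReal (Real.exp (-1 * ‖y‖ ^ 2)) =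
      M e * ENNReal.ofReal (gaussMoment (n - j) (-a)) := by
    have h1 : ∀ᵐ y : E (n - j), M y * ENNReal.ofReal (Real.exp (-1 * ‖y‖ ^ 2)) =
        M e * (‖y‖ₑ ^ (-a) * ENNReal.ofReal (Real.exp (-1 * ‖y‖ ^ 2))) := by
      filter_upwards [ae_ne_zero hd] with y hy
      rw [hM y hy, mul_assoc]
    rw [lintegral_congr_ae h1, lintegral_const_mul _ (by fun_prop),
      lintegral_enorm_rpow_mul_exp hd (by linarith) one_pos]
    simp
  have hright : ∫⁻ y, M y * ENNReal.ofReal (Real.exp (-1 * ‖y‖ ^ 2)) =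
      ENNReal.ofReal (Real.pi ^ (((k - j : ℕ) : ℝ) / 2)) *
        ENNReal.ofReal (gaussMoment (n - k) (-a)) := by
    have h2 : Measurable fun x : E (n - j) × fixSubgroup n j =>
        ENNReal.ofReal (Real.exp (-1 * ‖actCompl x.2⁻¹ x.1‖ ^ 2)) := by
      simp only [LinearIsometryEquiv.norm_map]
      fun_prop
    refine (lintegral_congr hexp).trans ?_
    refine (lintegral_lintegral_swap (hmeas.mul h2).aemeasurable).trans ?_
    have h3 : ∀ ρ : fixSubgroup n j, ∫⁻ y, ‖compTail n j k (actCompl ρ⁻¹ y)‖ₑ ^ (-a) *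
        ENNReal.ofReal (Real.exp (-1 * ‖actCompl ρ⁻¹ y‖ ^ 2)) =
        ENNReal.ofReal (Real.pi ^ (((k - j : ℕ) : ℝ) / 2)) *
          ENNReal.ofReal (gaussMoment (n - k) (-a)) := by
      intro ρ
      rw [← lintegral_exp_mul_enorm_compTail hjk hk ha]
      have hmp := (actCompl ρ⁻¹).measurePreserving
      have h4 := hmp.lintegral_comp_emb (actCompl ρ⁻¹).toMeasurableEquiv.measurableEmbedding
        (fun y => ‖compTail n j k y‖ₑ ^ (-a) * ENNReal.ofReal (Real.exp (-1 * ‖y‖ ^ 2)))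
      exact h4
    refine (lintegral_congr h3).trans ?_
    rw [lintegral_const, measure_univ, mul_one]
  have hI := gaussMoment_pos hd (c := -a) (by linarith)
  have hI' : ENNReal.ofReal (gaussMoment (n - j) (-a)) ≠ 0 := by simpa using hI
  have hval : M e = ENNReal.ofReal (momentConst (n - j) (n - k) a) := by
    -- The Gaussian moment is positive and finite, so it can be cancelled between the two
    -- evaluations.
    refine (ENNReal.mul_left_inj hI' ENNReal.ofReal_ne_top).1 ?_
    rw [← hleft, hright, ← ENNReal.ofReal_mul (by positivity),
      ← ENNReal.ofReal_mul (momentConst_pos (by omega) (by omega) ha).le]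
    congr 1
    have g1 := Real.Gamma_pos_of_pos (s := ((n - k : ℕ) : ℝ) / 2) (by linarith)
    have g2 := Real.Gamma_pos_of_pos (s := ((n - j : ℕ) : ℝ) / 2) (by linarith)
    have g3 := Real.Gamma_pos_of_pos (s := (((n - j : ℕ) : ℝ) - a) / 2) (by linarith)
    have hpi : Real.pi ^ (((n - j : ℕ) : ℝ) / 2) =
        Real.pi ^ (((k - j : ℕ) : ℝ) / 2) * Real.pi ^ (((n - k : ℕ) : ℝ) / 2) := by
      rw [← Real.rpow_add Real.pi_pos, hdm]
      congr 1
      ring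
    rw [gaussMoment, gaussMoment, momentConst, hpi, ← sub_eq_add_neg, ← sub_eq_add_neg]
    field_simp
  change M y = _
  rw [hM y hy, hval]

/-! ### The upper bound -/

/-- The distance to the origin, as an extended nonnegative number. -/
def edist {n k : ℕ} {h : k ≤ n} (τ : AffPlane h) : ℝ≥0∞ := ENNReal.ofReal τ.dist

theorem edist_param {n k : ℕ} (h : k ≤ n) (q : O n × E (n - k)) :
    edist (param h q) = ‖q.2‖ₑ := by
  rw [edist, dist_param, ofReal_norm]

theorem measurable_edist {n k : ℕ} {h : k ≤ n} : Measurable fun τ : AffPlane h => edist τ :=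
  measurable_dist.ennreal_ofReal

theorem edist_ne_top {n k : ℕ} {h : k ≤ n} (τ : AffPlane h) : edist τ ≠ ∞ := ENNReal.ofReal_ne_top

theorem ae_edist_ne_zero {n k : ℕ} {h : k ≤ n} (hkn : k < n) :
    ∀ᵐ τ ∂(planeMeasure h), edist τ ≠ 0 := by
  filter_upwards [ae_dist_pos hkn] with τ hτ
  simpa [edist] using hτ

/-- The transform sends powers of the distance to powers of the distance. This makes |τ|^{-a} the
right Hölder weight for the upper bound and the model extremal for the lower bound. -/
theorem lowerDual_edist {n j k : ℕ} {hj : j ≤ n} {hk : k ≤ n} (hjk : j < k) (hkn : k < n) {a : ℝ}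
    (ha : a < (n - k : ℕ)) {ζ : AffPlane hj} (hζ : edist ζ ≠ 0) :
    lowerDual (fun τ : AffPlane hk => edist τ ^ (-a)) ζ =
      ENNReal.ofReal (momentConst (n - j) (n - k) a) * edist ζ ^ (-a) := by
  obtain ⟨q, rfl⟩ := param_surjective hj ζ
  rw [edist_param] at hζ ⊢
  rw [lowerDual_param hjk.le, ← lintegral_enorm_compTail hjk hkn ha (by simpa using hζ)]
  simp only [edist_param, paramThrough]

/-- Hölder's inequality with the weight `s^{-a}`. -/
theorem lintegral_rpow_le_weighted {X : Type*} [MeasurableSpace X] {m : Measure X}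
    {s G : X → ℝ≥0∞} (hs : Measurable s) (hG : Measurable G) (hs0 : ∀ᵐ x ∂m, s x ≠ 0)
    (hst : ∀ x, s x ≠ ∞) {p : ℝ} (hp : 1 ≤ p) (a : ℝ) :
    (∫⁻ x, G x ∂m) ^ p ≤
      (∫⁻ x, s x ^ (-a) ∂m) ^ (p - 1) * ∫⁻ x, s x ^ (a * (p - 1)) * G x ^ p ∂m := by
  have hp0 : 0 < p := by linarith
  -- The weights cancel in G = (s^{-a})^{1-1/p} (s^{a(p-1)} G^p)^{1/p}. Hölder with exponents
  -- summing to 1 also covers p = 1, where the first exponent is 0.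
  have h1 : ∫⁻ x, G x ∂m = ∫⁻ x, (s x ^ (-a)) ^ (1 - p⁻¹) *
      (s x ^ (a * (p - 1)) * G x ^ p) ^ p⁻¹ ∂m := by
    refine lintegral_congr_ae ?_
    filter_upwards [hs0] with x hx
    rw [ENNReal.mul_rpow_of_nonneg _ _ (inv_nonneg.2 hp0.le), ← ENNReal.rpow_mul,
      ← ENNReal.rpow_mul, ← ENNReal.rpow_mul, mul_inv_cancel₀ hp0.ne', ENNReal.rpow_one,
      ← mul_assoc, ← ENNReal.rpow_add _ _ hx (hst x)]
    have : -a * (1 - p⁻¹) + a * (p - 1) * p⁻¹ = 0 := by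
      field_simp
      ring
    rw [this, ENNReal.rpow_zero, one_mul]
  have hm : Measurable fun x => s x ^ (a * (p - 1)) * G x ^ p :=
    (hs.pow_const (a * (p - 1))).mul (hG.pow_const p)
  have h2 := ENNReal.lintegral_mul_norm_pow_le (μ := m) (hs.pow_const (-a)).aemeasurable
    hm.aemeasurable (p := 1 - p⁻¹) (q := p⁻¹)
    (by rw [sub_nonneg]; exact inv_le_one_of_one_le₀ hp) (inv_nonneg.2 hp0.le) (by ring)
  rw [← h1] at h2
  refine (ENNReal.rpow_le_rpow h2 hp0.le).trans_eq ?_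
  rw [ENNReal.mul_rpow_of_nonneg _ _ hp0.le, ← ENNReal.rpow_mul, ← ENNReal.rpow_mul,
    inv_mul_cancel₀ hp0.ne', ENNReal.rpow_one]
  congr 2
  field_simp

/-- A Schur-type argument: weighted Hölder on the k-planes through ζ, then the incidence formula.
The value a = (n - k)/p + μ makes the final power of |τ| equal to μp. -/
theorem lintegral_lowerDual_rpow_le {n j k : ℕ} {hj : j ≤ n} {hk : k ≤ n} (hjk : j < k)
    (hkn : k < n) {p μ ν a : ℝ} (hp : 1 ≤ p) (ha : a = (n - k : ℕ) / p + μ)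
    (hν : ν = μ - (k - j : ℕ) / p) (had : a < (n - k : ℕ))
    {G : AffPlane hk → ℝ≥0∞} (hG : Measurable G) :
    ∫⁻ ζ : AffPlane hj, (edist ζ ^ ν * lowerDual G ζ) ^ p ∂(planeMeasure hj) ≤
      ENNReal.ofReal (momentConst (n - j) (n - k) a) ^ (p - 1) *
        ENNReal.ofReal (Real.pi ^ (((k - j : ℕ) : ℝ) / 2) *
          Real.Gamma (((n - k : ℕ) - a) / 2) / Real.Gamma (((n - j : ℕ) - a) / 2)) *
        ∫⁻ τ, (edist τ ^ μ * G τ) ^ p ∂(planeMeasure hk) := by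
  have hp0 : 0 < p := by linarith
  have hdm : ((n - j : ℕ) : ℝ) = (n - k : ℕ) + (k - j : ℕ) := by
    exact_mod_cast (by omega : n - j = (n - k) + (k - j))
  set M := ENNReal.ofReal (momentConst (n - j) (n - k) a)
  set K := ENNReal.ofReal (Real.pi ^ (((k - j : ℕ) : ℝ) / 2) *
          Real.Gamma (((n - k : ℕ) - a) / 2) / Real.Gamma (((n - j : ℕ) - a) / 2)) with hK
  have hd : 0 < n - k := by omega
  have hpt : ∀ᵐ ζ ∂(planeMeasure hj), (edist ζ ^ ν * lowerDual G ζ) ^ p ≤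
      edist ζ ^ (a - (n - j : ℕ)) * (M ^ (p - 1) *
        lowerDual (fun τ : AffPlane hk => edist τ ^ (a * (p - 1)) * G τ ^ p) ζ) := by
    filter_upwards [ae_edist_ne_zero (h := hj) (by omega),
      ae_ae_planeThrough hjk.le (hj := hj) (ae_edist_ne_zero (h := hk) hkn)] with ζ hζ hρ
    have hth := measurable_planeThrough hjk.le (hk := hk) ζ
    have h := lintegral_rpow_le_weighted (measurable_edist.comp hth :) (hG.comp hth :) hρ
      (fun _ => edist_ne_top _) hp a
    have h' : lowerDual G ζ ^ p ≤ (M * edist ζ ^ (-a)) ^ (p - 1) *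
        lowerDual (fun τ : AffPlane hk => edist τ ^ (a * (p - 1)) * G τ ^ p) ζ := by
      rw [← lowerDual_edist (hk := hk) hjk hkn had hζ]
      exact h
    rw [ENNReal.mul_rpow_of_nonneg _ _ hp0.le]
    refine (mul_le_mul_right h' _).trans_eq ?_
    rw [ENNReal.mul_rpow_of_nonneg _ _ (by linarith), ← ENNReal.rpow_mul, ← ENNReal.rpow_mul,
      mul_comm (M ^ (p - 1)), ← mul_assoc, ← mul_assoc, ← mul_assoc,
      ← ENNReal.rpow_add _ _ hζ (edist_ne_top _)]
    -- The exponents satisfy νp - a(p - 1) = a - (n - j).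
    congr 3
    rw [hν, hdm, ha]
    field_simp
    ring
  refine (lintegral_mono_ae hpt).trans_eq ?_
  have hHm : Measurable fun τ : AffPlane hk => edist τ ^ (a * (p - 1)) * G τ ^ p :=
    (measurable_edist.pow_const _).mul (hG.pow_const _)
  have hL : Measurable fun ζ : AffPlane hj => edist ζ ^ (a - (n - j : ℕ)) * (M ^ (p - 1) *
      lowerDual (fun τ : AffPlane hk => edist τ ^ (a * (p - 1)) * G τ ^ p) ζ) :=
    (measurable_edist.pow_const _).mul (measurable_const.mul (measurable_lowerDual hjk.le hHm))
  have hR : Measurable fun τ : AffPlane hk => (edist τ ^ μ * G τ) ^ p :=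
    ((measurable_edist.pow_const _).mul hG).pow_const _
  rw [lintegral_planeMeasure hL, lintegral_planeMeasure hR]
  let F : ℝ × (O n × E (n - k)) → ℝ≥0∞ := fun x =>
    ENNReal.ofReal x.1 ^ (a - (n - j : ℕ)) *
      (M ^ (p - 1) * (edist (param hk x.2) ^ (a * (p - 1)) * G (param hk x.2) ^ p))
  have hF : Measurable F := by
    have h0 : Measurable fun x : ℝ × (O n × E (n - k)) => param hk x.2 :=
      (measurable_param hk).comp measurable_snd
    have h1 := hHm.comp h0
    have h3 : Measurable fun x : ℝ × (O n × E (n - k)) =>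
      ENNReal.ofReal x.1 ^ (a - (n - j : ℕ)) := by fun_prop
    exact h3.mul (measurable_const.mul h1)
  have e1 : ∀ q : O n × E (n - j), edist (param hj q) ^ (a - (n - j : ℕ)) * (M ^ (p - 1) *
      lowerDual (fun τ : AffPlane hk => edist τ ^ (a * (p - 1)) * G τ ^ p) (param hj q)) =
      ∫⁻ ρ, F (‖q.2‖, paramThrough k q ρ) ∂(probHaar (fixSubgroup n j)) := by
    intro q
    have hm : Measurable fun ρ : fixSubgroup n j =>
        edist (param hk (paramThrough k q ρ)) ^ (a * (p - 1)) *
          G (param hk (paramThrough k q ρ)) ^ p :=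
      (hHm.comp ((measurable_param_paramThrough (j := j) hk).comp
        (measurable_prodMk_left (x := q))) :)
    rw [lowerDual_param hjk.le, edist_param, ← ofReal_norm, ← lintegral_const_mul _ hm,
      ← lintegral_const_mul _ (hm.const_mul _)]
  have e2 : ∀ᵐ q : O n × E (n - k) ∂((probHaar (O n)).prod volume),
      (∫⁻ z : E (k - j), F (√(‖z‖ ^ 2 + ‖q.2‖ ^ 2), q)) =
        M ^ (p - 1) * K * (edist (param hk q) ^ μ * G (param hk q)) ^ p := by
    have h2 : ∀ᵐ q : O n × E (n - k) ∂((probHaar (O n)).prod volume), q.2 ≠ 0 :=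
      Measure.quasiMeasurePreserving_snd.ae (ae_ne_zero hd)
    filter_upwards [h2] with q hq
    have hr : 0 < ‖q.2‖ := norm_pos_iff.2 hq
    have hz : ∀ z : E (k - j), ENNReal.ofReal √(‖z‖ ^ 2 + ‖q.2‖ ^ 2) ^ (a - (n - j : ℕ)) =
        ENNReal.ofReal (‖q.2‖ ^ 2 + ‖z‖ ^ 2) ^
          (-(((n - k : ℕ) : ℝ) + ((k - j : ℕ) - a)) / 2) := by
      intro z
      rw [← Real.sq_sqrt (show 0 ≤ ‖q.2‖ ^ 2 + ‖z‖ ^ 2 by positivity),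
        ENNReal.ofReal_pow (Real.sqrt_nonneg _), ← ENNReal.rpow_natCast, ← ENNReal.rpow_mul,
        add_comm (‖q.2‖ ^ 2), hdm]
      congr 1
      push_cast
      ring
    simp only [F, hz]
    rw [lintegral_mul_const _ (by fun_prop),
      lintegral_add_sq_rpow (by omega) hd had hr, ← hdm, ← hK, edist_param, ofReal_norm,
      ENNReal.mul_rpow_of_nonneg _ _ hp0.le, ← ENNReal.rpow_mul]
    -- The z-integral produced the exponent a - (n - k); with the Hölder weight a(p - 1) it adds up
    -- to ap - (n - k) = μp.
    have hexp : ‖q.2‖ₑ ^ (μ * p) = ‖q.2‖ₑ ^ (a - (n - k : ℕ)) * ‖q.2‖ₑ ^ (a * (p - 1)) := by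
      rw [← ENNReal.rpow_add _ _ (by simpa using hq) (by simp), ha]
      congr 1
      field_simp
      ring
    rw [hexp]
    ring
  refine (lintegral_congr e1).trans ((lintegral_paramThrough hjk.le hk hF).trans ?_)
  refine (lintegral_congr_ae e2).trans ?_
  exact lintegral_const_mul _ (hR.comp (measurable_param hk) :)

/-! ### The norm constant and the upper bound for all p -/

/-- The norm of the dual transform on `Lᵖ` with the weight exponent `μ`, with `P = 1/p`, `d = n - j`
and `d' = n - k`. -/
def normConst (d d' : ℕ) (P μ : ℝ) : ℝ :=
  momentConst d d' (d' * P + μ) * (sphereArea d / sphereArea d') ^ P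

theorem normConst_pos {d d' : ℕ} (hd' : 0 < d') (hd : d' ≤ d) {P μ : ℝ} (h : d' * P + μ < d') :
    0 < normConst d d' P μ :=
  mul_pos (momentConst_pos hd' hd h)
    (Real.rpow_pos_of_pos (div_pos (sphereArea_pos (by omega)) (sphereArea_pos hd')) _)

/-- The constant of the z-integral is again the moment constant, up to the ratio of sphere areas; so
M^{p-1} from Hölder becomes M^p, with an exact p-th root. -/
theorem pi_mul_Gamma_div_eq {m d' d : ℕ} (hd' : 0 < d') (hd : d = d' + m) {a : ℝ} (ha : a < d') :
    Real.pi ^ ((m : ℝ) / 2) * Real.Gamma ((d' - a) / 2) / Real.Gamma ((d - a) / 2) =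
      momentConst d d' a * (sphereArea d / sphereArea d') := by
  have h1 : (0 : ℝ) < d' := by exact_mod_cast hd'
  have hm : (0 : ℝ) ≤ m := Nat.cast_nonneg m
  have hdr : (d : ℝ) = d' + m := by exact_mod_cast hd
  have g1 := Real.Gamma_pos_of_pos (s := (d' : ℝ) / 2) (by linarith)
  have g2 := Real.Gamma_pos_of_pos (s := (d : ℝ) / 2) (by linarith)
  have g3 := Real.Gamma_pos_of_pos (s := ((d : ℝ) - a) / 2) (by linarith)
  have hpi : Real.pi ^ ((d : ℝ) / 2) = Real.pi ^ ((m : ℝ) / 2) * Real.pi ^ ((d' : ℝ) / 2) := by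
    rw [← Real.rpow_add Real.pi_pos, hdr]
    congr 1
    ring
  have hpi' := Real.rpow_pos_of_pos Real.pi_pos ((d' : ℝ) / 2)
  rw [momentConst, sphereArea, sphereArea, hpi]
  field_simp

theorem normConst_eq {m d' d : ℕ} (hd' : 0 < d') (hd : d = d' + m) {P μ : ℝ}
    (h : d' * P + μ < d') :
    normConst d d' P μ = Real.pi ^ ((m : ℝ) / 2) * (sphereArea d' / sphereArea d) ^ (1 - P) *
      (Real.Gamma ((d' * (1 - P) - μ) / 2) / Real.Gamma ((d * (1 - P) + m * P - μ) / 2)) := by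
  have hs := sphereArea_pos hd'
  have hs' := sphereArea_pos (d := d) (by omega)
  have hdr : (d : ℝ) = d' + m := by exact_mod_cast hd
  have h1 := pi_mul_Gamma_div_eq hd' hd h
  have e1 : (d' : ℝ) - (d' * P + μ) = d' * (1 - P) - μ := by ring
  have e2 : (d : ℝ) - (d' * P + μ) = d * (1 - P) + m * P - μ := by rw [hdr]; ring
  rw [e1, e2] at h1
  have h2 : (sphereArea d / sphereArea d') ^ P =
      (sphereArea d / sphereArea d') * (sphereArea d' / sphereArea d) ^ (1 - P) := by
    rw [← inv_div (sphereArea d), Real.inv_rpow (by positivity), ← Real.rpow_neg (by positivity)]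
    nth_rw 2 [← Real.rpow_one (sphereArea d / sphereArea d')]
    rw [← Real.rpow_add (by positivity)]
    congr 1
    ring
  rw [normConst, h2, ← mul_assoc, ← h1]
  ring

theorem eLpNorm_lowerDual_le {n j k : ℕ} {hj : j ≤ n} {hk : k ≤ n} (hjk : j < k) (hkn : k < n)
    {p : ℝ≥0∞} (hp : 1 ≤ p) {P μ ν : ℝ} (hP : P = (1 / p).toReal) (hν : ν = μ - (k - j : ℕ) * P)
    (had : (n - k : ℕ) * P + μ < (n - k : ℕ)) {G : AffPlane hk → ℝ≥0∞} (hG : Measurable G) :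
    eLpNorm (fun ζ : AffPlane hj => edist ζ ^ ν * lowerDual G ζ) p (planeMeasure hj) ≤
      ENNReal.ofReal (normConst (n - j) (n - k) P μ) *
        eLpNorm (fun τ => edist τ ^ μ * G τ) p (planeMeasure hk) := by
  have hd' : 0 < n - k := by omega
  have hd : n - j = (n - k) + (k - j) := by omega
  rcases eq_or_ne p ∞ with rfl | hpt
  · obtain rfl : P = 0 := by simpa using hP
    rw [mul_zero, sub_zero] at hν
    rw [mul_zero, zero_add] at had
    subst hν
    rw [eLpNorm_exponent_top, eLpNorm_exponent_top, normConst, Real.rpow_zero, mul_one, mul_zero,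
      zero_add]
    set B := eLpNormEssSup (fun τ => edist τ ^ ν * G τ) (planeMeasure hk) with hB
    refine eLpNormEssSup_le_of_ae_enorm_bound ?_
    -- For p = ∞ the function is dominated by a multiple of |τ|^{-ν}, with ν = μ here, and the
    -- moment formula evaluates the transform of the majorant.
    have h1 : ∀ᵐ τ ∂(planeMeasure hk), G τ ≤ B * edist τ ^ (-ν) := by
      filter_upwards [ae_edist_ne_zero (h := hk) hkn, ae_le_eLpNormEssSup
        (f := fun τ => edist τ ^ ν * G τ) (μ := planeMeasure hk)] with τ hτ hle
      rw [enorm_eq_self, ← hB] at hle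
      calc G τ = edist τ ^ ν * G τ * edist τ ^ (-ν) := by
            rw [mul_right_comm, ← ENNReal.rpow_add _ _ hτ (edist_ne_top _), add_neg_cancel,
              ENNReal.rpow_zero, one_mul]
        _ ≤ B * edist τ ^ (-ν) := mul_le_mul_left hle _
    filter_upwards [ae_edist_ne_zero (h := hj) (by omega), ae_ae_planeThrough hjk.le (hj := hj) h1]
      with ζ hζ hρ
    rw [enorm_eq_self]
    have h2 : lowerDual G ζ ≤ B * lowerDual (fun τ : AffPlane hk => edist τ ^ (-ν)) ζ := by
      have hm : Measurable fun ρ : fixSubgroup n j => edist (planeThrough hk ζ ρ) ^ (-ν) :=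
        ((measurable_edist.pow_const (-ν)).comp (measurable_planeThrough hjk.le (hk := hk) ζ) :)
      rw [lowerDual, lowerDual, ← lintegral_const_mul _ hm]
      exact lintegral_mono_ae hρ
    rw [lowerDual_edist hjk hkn had hζ] at h2
    refine (mul_le_mul_right h2 _).trans_eq ?_
    have h3 : edist ζ ^ ν * edist ζ ^ (-ν) = 1 := by
      rw [← ENNReal.rpow_add _ _ hζ (edist_ne_top _), add_neg_cancel, ENNReal.rpow_zero]
    calc _ = ENNReal.ofReal (momentConst (n - j) (n - k) ν) * B * (edist ζ ^ ν * edist ζ ^ (-ν)) := by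
          ring
      _ = _ := by rw [h3, mul_one]
  · have hp0 : p ≠ 0 := (zero_lt_one.trans_le hp).ne'
    have hpr : 1 ≤ p.toReal := by
      rw [← ENNReal.toReal_one]
      exact ENNReal.toReal_mono hpt hp
    have hpr0 : 0 < p.toReal := by linarith
    have hP' : P = 1 / p.toReal := by rw [hP, ENNReal.toReal_div, ENNReal.toReal_one]
    set r := p.toReal with hr
    rw [eLpNorm_eq_lintegral_rpow_enorm_toReal hp0 hpt,
      eLpNorm_eq_lintegral_rpow_enorm_toReal hp0 hpt]
    simp only [enorm_eq_self]
    have h := lintegral_lowerDual_rpow_le (hj := hj) hjk hkn hpr (μ := μ) (ν := ν)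
      (a := (n - k : ℕ) * P + μ) (by rw [hP']; ring) (by rw [hν, hP']; ring) had hG
    rw [pi_mul_Gamma_div_eq hd' hd had] at h
    refine (ENNReal.rpow_le_rpow h (by positivity)).trans_eq ?_
    rw [ENNReal.mul_rpow_of_nonneg _ _ (by positivity)]
    congr 1
    have hM := momentConst_pos hd' (by omega : n - k ≤ n - j) had
    have hs := div_pos (sphereArea_pos (d := n - j) (by omega)) (sphereArea_pos hd')
    rw [ENNReal.ofReal_rpow_of_pos hM, ← ENNReal.ofReal_mul (by positivity),
      ENNReal.ofReal_rpow_of_pos (by positivity)]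
    congr 1
    rw [← mul_assoc, ← Real.rpow_add_one hM.ne', sub_add_cancel, Real.mul_rpow (by positivity)
      hs.le, ← Real.rpow_mul hM.le, mul_one_div_cancel hpr0.ne', Real.rpow_one, normConst, ← hP']

/-! ### The operator -/

variable {𝕜 : Type*} [RCLike 𝕜]

theorem enorm_distPow_smul {n k : ℕ} {h : k ≤ n} (ν : ℝ) {τ : AffPlane h} (hτ : edist τ ≠ 0)
    (z : 𝕜) : ‖distPow h ν τ • z‖ₑ = edist τ ^ ν * ‖z‖ₑ := by
  have hτ' : 0 < τ.dist := by simpa [edist] using hτ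
  rw [enorm_smul, distPow, edist, ENNReal.ofReal_rpow_of_pos hτ',
    Real.enorm_of_nonneg (Real.rpow_nonneg hτ'.le _)]

/-- Real and extended powers disagree at 0 for negative exponents, but only planes through the
origin are affected, and they form a null set. -/
theorem eLpNorm_distPow_smul {n k : ℕ} {h : k ≤ n} (hkn : k < n) (ν : ℝ) (p : ℝ≥0∞)
    (φ : AffPlane h → 𝕜) : eLpNorm (fun τ => distPow h ν τ • φ τ) p (planeMeasure h) =
      eLpNorm (fun τ => edist τ ^ ν * ‖φ τ‖ₑ) p (planeMeasure h) := by
  refine eLpNorm_congr_enorm_ae ?_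
  filter_upwards [ae_edist_ne_zero (h := h) hkn] with τ hτ
  rw [enorm_distPow_smul ν hτ, enorm_eq_self]

theorem ae_lt_top_of_eLpNorm_ne_top {X : Type*} [MeasurableSpace X] {m : Measure X} {p : ℝ≥0∞}
    (hp : p ≠ 0) {f : X → ℝ≥0∞} (hf : Measurable f) (h : eLpNorm f p m ≠ ∞) :
    ∀ᵐ x ∂m, f x < ∞ := by
  rcases eq_or_ne p ∞ with rfl | hpt
  · rw [eLpNorm_exponent_top] at h
    filter_upwards [ae_le_eLpNormEssSup (f := f) (μ := m)] with x hx
    exact hx.trans_lt h.lt_top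
  · have hpr := ENNReal.toReal_pos hp hpt
    rw [eLpNorm_eq_lintegral_rpow_enorm_toReal hp hpt] at h
    have h1 : ∫⁻ x, f x ^ p.toReal ∂m ≠ ∞ := by
      intro h2
      simp only [enorm_eq_self, h2] at h
      exact h (ENNReal.top_rpow_of_pos (by positivity))
    filter_upwards [ae_lt_top (hf.pow_const _) h1] with x hx
    exact (ENNReal.rpow_lt_top_iff_of_pos hpr).1 hx

section Transform

variable {n j k : ℕ} {hj : j ≤ n} {hk : k ≤ n}

/-- This makes the transform well defined on almost-everywhere classes: for almost every ζ, almost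
every k-plane through ζ avoids the exceptional set. -/
theorem ae_dualTransform_congr (hjk : j ≤ k) {φ ψ : AffPlane hk → 𝕜}
    (h : φ =ᵐ[planeMeasure hk] ψ) :
    ∀ᵐ ζ ∂(planeMeasure hj), (DualConverges φ ζ ↔ DualConverges ψ ζ) ∧
      dualTransform φ ζ = dualTransform ψ ζ ∧
      lowerDual (fun τ => ‖φ τ‖ₑ) ζ = lowerDual (fun τ => ‖ψ τ‖ₑ) ζ := by
  filter_upwards [ae_ae_planeThrough hjk (hj := hj) h] with ζ hζ
  refine ⟨integrable_congr hζ, integral_congr_ae hζ, lintegral_congr_ae ?_⟩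
  filter_upwards [hζ] with ρ hρ
  rw [hρ]

theorem aestronglyMeasurable_dualTransform (hjk : j ≤ k) {φ : AffPlane hk → 𝕜}
    (hφ : AEStronglyMeasurable φ (planeMeasure hk)) :
    AEStronglyMeasurable (dualTransform φ) (planeMeasure hj) :=
  ⟨dualTransform (hφ.mk φ),
    (measurable_dualTransform hjk hφ.stronglyMeasurable_mk.measurable).stronglyMeasurable, by
      filter_upwards [ae_dualTransform_congr hjk hφ.ae_eq_mk] with ζ hζ using hζ.2.1⟩

theorem eLpNorm_lowerDual_enorm_le (hjk : j < k) (hkn : k < n) {p : ℝ≥0∞} (hp : 1 ≤ p)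
    {P μ ν : ℝ} (hP : P = (1 / p).toReal) (hν : ν = μ - (k - j : ℕ) * P)
    (had : (n - k : ℕ) * P + μ < (n - k : ℕ)) {φ : AffPlane hk → 𝕜}
    (hφ : AEStronglyMeasurable φ (planeMeasure hk)) :
    eLpNorm (fun ζ : AffPlane hj => edist ζ ^ ν * lowerDual (fun τ => ‖φ τ‖ₑ) ζ) p
        (planeMeasure hj) ≤
      ENNReal.ofReal (normConst (n - j) (n - k) P μ) *
        eLpNorm (fun τ => distPow hk μ τ • φ τ) p (planeMeasure hk) := by
  have hψ : Measurable (hφ.mk φ) := hφ.stronglyMeasurable_mk.measurable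
  have h := eLpNorm_lowerDual_le (hj := hj) hjk hkn hp hP hν had hψ.enorm
  rw [eLpNorm_distPow_smul hkn]
  refine Eq.trans_le (eLpNorm_congr_ae ?_) (h.trans_eq (congrArg _ (eLpNorm_congr_ae ?_)))
  · filter_upwards [ae_dualTransform_congr hjk.le (hj := hj) hφ.ae_eq_mk] with ζ hζ
    rw [hζ.2.2]
  · filter_upwards [hφ.ae_eq_mk] with τ hτ
    rw [hτ]

theorem eLpNorm_dualTransform_le (hjk : j < k) (hkn : k < n) {p : ℝ≥0∞} (hp : 1 ≤ p)
    {P μ ν : ℝ} (hP : P = (1 / p).toReal) (hν : ν = μ - (k - j : ℕ) * P)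
    (had : (n - k : ℕ) * P + μ < (n - k : ℕ)) {φ : AffPlane hk → 𝕜}
    (hφ : AEStronglyMeasurable φ (planeMeasure hk)) :
    eLpNorm (fun ζ => distPow hj ν ζ • dualTransform φ ζ) p (planeMeasure hj) ≤
      ENNReal.ofReal (normConst (n - j) (n - k) P μ) *
        eLpNorm (fun τ => distPow hk μ τ • φ τ) p (planeMeasure hk) := by
  refine le_trans ?_ (eLpNorm_lowerDual_enorm_le (hj := hj) hjk hkn hp hP hν had hφ)
  rw [eLpNorm_distPow_smul (by omega)]
  refine eLpNorm_mono_enorm fun ζ => ?_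
  rw [enorm_eq_self, enorm_eq_self]
  exact mul_le_mul_right (enorm_integral_le_lintegral_enorm _) _

theorem ae_dualConverges (hjk : j < k) (hkn : k < n) {p : ℝ≥0∞} (hp : 1 ≤ p)
    {P μ : ℝ} (hP : P = (1 / p).toReal)
    (had : (n - k : ℕ) * P + μ < (n - k : ℕ)) {φ : AffPlane hk → 𝕜}
    (hφ : AEStronglyMeasurable φ (planeMeasure hk))
    (hφμ : MemLp (fun τ => distPow hk μ τ • φ τ) p (planeMeasure hk)) :
    ∀ᵐ ζ ∂(planeMeasure hj), DualConverges φ ζ := by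
  have hψ : Measurable (hφ.mk φ) := hφ.stronglyMeasurable_mk.measurable
  have hcongr := ae_dualTransform_congr hjk.le (hj := hj) hφ.ae_eq_mk
  have h := eLpNorm_lowerDual_enorm_le (hj := hj) hjk hkn hp hP rfl had hφ
  have hfin : eLpNorm (fun ζ : AffPlane hj => edist ζ ^ (μ - (k - j : ℕ) * P) *
      lowerDual (fun τ => ‖hφ.mk φ τ‖ₑ) ζ) p (planeMeasure hj) ≠ ∞ := by
    refine ne_top_of_le_ne_top (ENNReal.mul_ne_top ENNReal.ofReal_ne_top hφμ.2.ne)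
      (Eq.trans_le (eLpNorm_congr_ae ?_) h)
    filter_upwards [hcongr] with ζ hζ
    rw [hζ.2.2]
  have hlt := ae_lt_top_of_eLpNorm_ne_top (zero_lt_one.trans_le hp).ne'
    ((measurable_edist.pow_const _).mul (measurable_lowerDual hjk.le hψ.enorm)) hfin
  filter_upwards [hcongr, hlt, ae_edist_ne_zero (h := hj) (by omega)] with ζ hζ hζlt hζ0
  refine hζ.1.2 ⟨(hψ.comp (measurable_planeThrough hjk.le ζ)).aestronglyMeasurable, ?_⟩
  refine lt_top_iff_ne_top.2 fun htop => ?_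
  have htop' : lowerDual (fun τ => ‖hφ.mk φ τ‖ₑ) ζ = ∞ := htop
  -- The weight |ζ|^ν is nonzero off the planes through the origin, so it cannot hide an infinite
  -- value of the transform.
  rw [Pi.mul_apply, htop', ENNReal.mul_top] at hζlt
  · exact lt_irrefl _ hζlt
  · simp [ENNReal.rpow_eq_zero_iff, hζ0, edist_ne_top]

/-- The dual transform as a bounded operator. -/
theorem exists_dualTransform_operator (hjk : j < k) (hkn : k < n) {p : ℝ≥0∞} [Fact (1 ≤ p)]
    {P μ ν : ℝ} (hP : P = (1 / p).toReal) (hν : ν = μ - (k - j : ℕ) * P)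
    (had : (n - k : ℕ) * P + μ < (n - k : ℕ)) :
    ∃ T : PlaneLp 𝕜 hk p μ →L[𝕜] PlaneLp 𝕜 hj p ν,
      (∀ (φ : AffPlane hk → 𝕜) (hφ : AEStronglyMeasurable φ (planeMeasure hk))
        (hφμ : MemLp (fun τ => distPow hk μ τ • φ τ) p (planeMeasure hk)),
        T (WLp.mk φ hφ hφμ) =ᵐ[planeMeasure hj] dualTransform φ) ∧
      ‖T‖ ≤ normConst (n - j) (n - k) P μ := by
  have hp : 1 ≤ p := Fact.out
  have hC := normConst_pos (by omega : 0 < n - k) (by omega : n - k ≤ n - j) had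
  have hmem : ∀ f : PlaneLp 𝕜 hk p μ,
      MemLp (fun ζ => distPow hj ν ζ • dualTransform f ζ) p (planeMeasure hj) := fun f => by
    have hm : Measurable (distPow hj ν) := measurable_dist.pow_const ν
    refine ⟨hm.aestronglyMeasurable.smul
      (aestronglyMeasurable_dualTransform hjk.le f.1.aestronglyMeasurable), ?_⟩
    exact (eLpNorm_dualTransform_le hjk hkn hp hP hν had f.1.aestronglyMeasurable).trans_lt
      (ENNReal.mul_lt_top ENNReal.ofReal_lt_top f.2.2)
  let L : PlaneLp 𝕜 hk p μ →ₗ[𝕜] PlaneLp 𝕜 hj p ν :=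
    { toFun := fun f => WLp.mk (dualTransform f)
        (aestronglyMeasurable_dualTransform hjk.le f.1.aestronglyMeasurable) (hmem f)
      -- Additivity of the Bochner integral needs convergence for both summands, known for almost
      -- every ζ; homogeneity below needs no such condition.
      map_add' := fun f g => by
        refine Subtype.ext (AEEqFun.ext ?_)
        refine (AEEqFun.coeFn_mk _ _).trans (Filter.EventuallyEq.trans ?_ (AEEqFun.coeFn_add _ _).symm)
        filter_upwards [ae_dualTransform_congr hjk.le (hj := hj) (AEEqFun.coeFn_add f.1 g.1),
          ae_dualConverges (hj := hj) hjk hkn hp hP had f.1.aestronglyMeasurable f.2,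
          ae_dualConverges (hj := hj) hjk hkn hp hP had g.1.aestronglyMeasurable g.2,
          AEEqFun.coeFn_mk (dualTransform f)
            (aestronglyMeasurable_dualTransform (hj := hj) hjk.le f.1.aestronglyMeasurable),
          AEEqFun.coeFn_mk (dualTransform g)
            (aestronglyMeasurable_dualTransform (hj := hj) hjk.le g.1.aestronglyMeasurable)]
          with ζ h1 h2 h3 h4 h5
        refine h1.2.1.trans ((integral_add h2 h3).trans ?_)
        exact (congrArg₂ (· + ·) h4 h5).symm
      map_smul' := fun c f => by
        refine Subtype.ext (AEEqFun.ext ?_)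
        refine (AEEqFun.coeFn_mk _ _).trans (Filter.EventuallyEq.trans ?_ (AEEqFun.coeFn_smul _ _).symm)
        filter_upwards [ae_dualTransform_congr hjk.le (hj := hj) (AEEqFun.coeFn_smul c f.1),
          AEEqFun.coeFn_mk (dualTransform f)
            (aestronglyMeasurable_dualTransform (hj := hj) hjk.le f.1.aestronglyMeasurable)]
          with ζ h1 h4
        refine h1.2.1.trans ((integral_smul c _).trans ?_)
        exact (congrArg (c • ·) h4).symm }
  have hL : ∀ f, ‖L f‖ ≤ normConst (n - j) (n - k) P μ * ‖f‖ := fun f => by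
    rw [WLp.norm_def, WLp.norm_def, ← ENNReal.toReal_ofReal hC.le, ← ENNReal.toReal_mul]
    refine ENNReal.toReal_mono (ENNReal.mul_ne_top ENNReal.ofReal_ne_top f.2.2.ne) ?_
    refine Eq.trans_le (eLpNorm_congr_ae ?_)
      (eLpNorm_dualTransform_le (hj := hj) hjk hkn hp hP hν had f.1.aestronglyMeasurable)
    filter_upwards [AEEqFun.coeFn_mk (dualTransform f)
      (aestronglyMeasurable_dualTransform (hj := hj) hjk.le f.1.aestronglyMeasurable)] with ζ hζ
    exact congrArg (distPow hj ν ζ • ·) hζ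
  refine ⟨L.mkContinuous _ hL, fun φ hφ hφμ => ?_, L.mkContinuous_norm_le hC.le hL⟩
  refine (AEEqFun.coeFn_mk _ _).trans ?_
  filter_upwards [ae_dualTransform_congr hjk.le (hj := hj) (AEEqFun.coeFn_mk φ hφ)] with ζ hζ
    using hζ.2.1

end Transform

/-! ### The lower bound -/

/-- The function `|τ|^c` on the planes at distance less than one from the origin. -/
def truncPow {n k : ℕ} {h : k ≤ n} (c : ℝ) (τ : AffPlane h) : ℝ≥0∞ :=
  {τ : AffPlane h | edist τ < 1}.indicator (fun τ => edist τ ^ c) τ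

theorem measurableSet_edist_lt_one {n k : ℕ} {h : k ≤ n} :
    MeasurableSet {τ : AffPlane h | edist τ < 1} :=
  measurableSet_lt measurable_edist measurable_const

theorem measurable_truncPow {n k : ℕ} {h : k ≤ n} (c : ℝ) :
    Measurable (truncPow c : AffPlane h → ℝ≥0∞) :=
  (measurable_edist.pow_const c).indicator measurableSet_edist_lt_one

theorem truncPow_of_lt {n k : ℕ} {h : k ≤ n} (c : ℝ) {τ : AffPlane h} (hτ : edist τ < 1) :
    truncPow c τ = edist τ ^ c :=
  Set.indicator_of_mem (s := {τ : AffPlane h | edist τ < 1}) hτ _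

theorem truncPow_of_not_lt {n k : ℕ} {h : k ≤ n} (c : ℝ) {τ : AffPlane h} (hτ : ¬edist τ < 1) :
    truncPow c τ = 0 :=
  Set.indicator_of_notMem (s := {τ : AffPlane h | edist τ < 1}) hτ _

theorem edist_rpow_mul_truncPow {n k : ℕ} {h : k ≤ n} (b c : ℝ) {τ : AffPlane h}
    (hτ : edist τ ≠ 0) : edist τ ^ b * truncPow c τ = truncPow (b + c) τ := by
  by_cases h1 : edist τ < 1
  · rw [truncPow_of_lt c h1, truncPow_of_lt _ h1, ENNReal.rpow_add _ _ hτ (edist_ne_top _)]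
  · rw [truncPow_of_not_lt c h1, truncPow_of_not_lt _ h1, mul_zero]

theorem lintegral_truncPow {n k : ℕ} {h : k ≤ n} (hkn : k < n) {δ : ℝ} (hδ : 0 < δ) :
    ∫⁻ τ : AffPlane h, truncPow (δ - (n - k : ℕ)) τ ∂(planeMeasure h) =
      ENNReal.ofReal (sphereArea (n - k) / δ) := by
  have hm := measurable_truncPow (h := h) (δ - (n - k : ℕ))
  have hmp : Measurable fun q => truncPow (δ - (n - k : ℕ)) (param h q) :=
    (hm.comp (measurable_param h) :)
  have h1 : ∀ q : O n × E (n - k), truncPow (δ - (n - k : ℕ)) (param h q) =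
      (Metric.ball (0 : E (n - k)) 1).indicator (fun u => ‖u‖ₑ ^ (δ - (n - k : ℕ))) q.2 := by
    intro q
    have h2 : edist (param h q) < 1 ↔ q.2 ∈ Metric.ball (0 : E (n - k)) 1 := by
      rw [edist, ENNReal.ofReal_lt_one, dist_param, mem_ball_zero_iff]
    by_cases h3 : edist (param h q) < 1
    · rw [truncPow_of_lt _ h3, Set.indicator_of_mem (h2.1 h3), edist_param]
    · rw [truncPow_of_not_lt _ h3, Set.indicator_of_notMem (mt h2.2 h3)]
  rw [lintegral_planeMeasure hm, lintegral_prod _ hmp.aemeasurable]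
  simp only [h1]
  rw [lintegral_const, measure_univ, mul_one, lintegral_indicator measurableSet_ball,
    lintegral_ball_enorm_rpow (by omega) hδ]

theorem planeMeasure_edist_lt_one_ne_zero {n k : ℕ} {h : k ≤ n} (hkn : k < n) :
    planeMeasure h {τ : AffPlane h | edist τ < 1} ≠ 0 := by
  intro h0
  have h1 := lintegral_truncPow (h := h) hkn one_pos
  have h2 : ∫⁻ τ : AffPlane h, truncPow (1 - (n - k : ℕ)) τ ∂(planeMeasure h) = 0 :=
    (lintegral_indicator measurableSet_edist_lt_one _).trans (setLIntegral_measure_zero _ _ h0)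
  rw [h2, div_one, eq_comm, ENNReal.ofReal_eq_zero] at h1
  exact absurd h1 (not_le.2 (sphereArea_pos (by omega)))

/-- Here δ measures the distance to the critical exponent -(n - k)/p. The factor δp is the same for
every k, so it cancels when the norms for j-planes and k-planes are compared. -/
theorem eLpNorm_truncPow {n k : ℕ} {h : k ≤ n} (hkn : k < n) {p : ℝ≥0∞} (hp : 1 ≤ p)
    (hpt : p ≠ ∞) {δ : ℝ} (hδ : 0 < δ) :
    eLpNorm (truncPow (δ - (n - k : ℕ) * (1 / p).toReal)) p (planeMeasure h) =
      ENNReal.ofReal ((sphereArea (n - k) / (δ * p.toReal)) ^ (1 / p).toReal) := by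
  have hp0 : p ≠ 0 := (zero_lt_one.trans_le hp).ne'
  have hpr := ENNReal.toReal_pos hp0 hpt
  have hP : (1 / p).toReal = 1 / p.toReal := by rw [ENNReal.toReal_div, ENNReal.toReal_one]
  have hs := sphereArea_pos (d := n - k) (by omega)
  rw [eLpNorm_eq_lintegral_rpow_enorm_toReal hp0 hpt, hP,
    ← ENNReal.ofReal_rpow_of_pos (by positivity), ← lintegral_truncPow (h := h) hkn (by positivity)]
  congr 1
  refine lintegral_congr fun τ => ?_
  rw [enorm_eq_self]
  by_cases h1 : edist τ < 1
  · rw [truncPow_of_lt _ h1, truncPow_of_lt _ h1, ← ENNReal.rpow_mul]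
    congr 1
    field_simp
  · rw [truncPow_of_not_lt _ h1, truncPow_of_not_lt _ h1, ENNReal.zero_rpow_of_pos hpr]

theorem eLpNorm_top_truncPow_zero {n k : ℕ} {h : k ≤ n} (hkn : k < n) :
    eLpNorm (truncPow 0) ∞ (planeMeasure h) = 1 := by
  have h1 : (truncPow 0 : AffPlane h → ℝ≥0∞) =
      {τ : AffPlane h | edist τ < 1}.indicator fun _ => 1 := by
    funext τ
    simp only [truncPow, ENNReal.rpow_zero]
  rw [h1, eLpNorm_exponent_top, eLpNormEssSup_indicator_const_eq _ _
    (planeMeasure_edist_lt_one_ne_zero hkn), enorm_eq_self]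

theorem norm_compTail_le {n j k : ℕ} (y : E (n - j)) : ‖compTail n j k y‖ ≤ ‖y‖ := by
  set x : E n := coordCompl j y with hx
  have h := norm_add_sq_eq_norm_sq_add_norm_sq_of_inner_eq_zero _ _
    (inner_coordPlane_coordCompl (sub_coordCompl_tailProj_mem (k := k) x) (tailProj k x))
  rw [sub_add_cancel, norm_coordCompl (tailProj k x)] at h
  rw [compTail_apply, ← norm_coordCompl y, ← hx]
  nlinarith [norm_nonneg x, norm_nonneg (tailProj k x),
    mul_self_nonneg ‖x - coordCompl k (tailProj k x)‖]

/-- The k-plane contains ζ, so it is at least as close to the origin; in coordinates, a projection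
shortens a rotated vector. -/
theorem edist_planeThrough_le {n j k : ℕ} (hjk : j ≤ k) {hj : j ≤ n} {hk : k ≤ n}
    (ζ : AffPlane hj) (ρ : fixSubgroup n j) : edist (planeThrough hk ζ ρ) ≤ edist ζ := by
  obtain ⟨q, rfl⟩ := param_surjective hj ζ
  obtain ⟨β, hβ⟩ := exists_planeThrough_param hjk hj hk q.1 q.2
  have h := hβ ρ
  rw [Prod.mk.eta] at h
  rw [h, edist_param, edist_param, ← ofReal_norm, ← ofReal_norm]
  refine ENNReal.ofReal_le_ofReal ((norm_compTail_le _).trans_eq ?_)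
  rw [LinearIsometryEquiv.norm_map]

/-- If |ζ| < 1, every k-plane through ζ is also inside the cutoff, so the moment formula for the
untruncated power applies. Otherwise the left side is zero. -/
theorem le_lowerDual_truncPow {n j k : ℕ} {hj : j ≤ n} {hk : k ≤ n} (hjk : j < k) (hkn : k < n)
    {b : ℝ} (hb : b < (n - k : ℕ)) {ζ : AffPlane hj} (hζ : edist ζ ≠ 0) :
    ENNReal.ofReal (momentConst (n - j) (n - k) b) * truncPow (-b) ζ ≤
      lowerDual (truncPow (-b) : AffPlane hk → ℝ≥0∞) ζ := by
  by_cases h1 : edist ζ < 1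
  · rw [truncPow_of_lt _ h1, ← lowerDual_edist (hk := hk) hjk hkn hb hζ]
    refine lintegral_mono fun ρ => ?_
    rw [truncPow_of_lt _ ((edist_planeThrough_le hjk.le ζ ρ).trans_lt h1)]
  · rw [truncPow_of_not_lt _ h1, mul_zero]
    exact bot_le

variable {n j k : ℕ} {hj : j ≤ n} {hk : k ≤ n}

theorem enorm_dualTransform_ofReal (hjk : j ≤ k) {φ : AffPlane hk → ℝ} (hφ0 : ∀ τ, 0 ≤ φ τ)
    (hφ : Measurable φ) {ζ : AffPlane hj} (hζ : DualConverges (fun τ => (φ τ : 𝕜)) ζ) :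
    ‖dualTransform (fun τ => (φ τ : 𝕜)) ζ‖ₑ = lowerDual (fun τ => ENNReal.ofReal (φ τ)) ζ := by
  have hi : Integrable (fun ρ => φ (planeThrough hk ζ ρ)) (probHaar (fixSubgroup n j)) := by
    refine ⟨(hφ.comp (measurable_planeThrough hjk ζ)).aestronglyMeasurable, ?_⟩
    refine (hasFiniteIntegral_congr' (.of_forall fun ρ => ?_)).1 hζ.2
    exact RCLike.norm_ofReal _
  rw [dualTransform, integral_ofReal, ← ofReal_norm, RCLike.norm_ofReal,
    abs_of_nonneg (integral_nonneg fun ρ => hφ0 _),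
    ofReal_integral_eq_lintegral_ofReal hi (.of_forall fun ρ => hφ0 _)]
  rfl

/-- A bounded operator given by the dual transform is bounded by its norm on nonnegative
functions. -/
theorem eLpNorm_lowerDual_le_opNorm (hjk : j < k) (hkn : k < n) {p : ℝ≥0∞} [Fact (1 ≤ p)]
    {P μ ν : ℝ} (hP : P = (1 / p).toReal) (had : (n - k : ℕ) * P + μ < (n - k : ℕ))
    (T : PlaneLp 𝕜 hk p μ →L[𝕜] PlaneLp 𝕜 hj p ν)
    (hT : ∀ (φ : AffPlane hk → 𝕜) (hφ : AEStronglyMeasurable φ (planeMeasure hk))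
      (hφμ : MemLp (fun τ => distPow hk μ τ • φ τ) p (planeMeasure hk)),
      T (WLp.mk φ hφ hφμ) =ᵐ[planeMeasure hj] dualTransform φ)
    {G : AffPlane hk → ℝ≥0∞} (hG : Measurable G) (hGt : ∀ᵐ τ ∂(planeMeasure hk), G τ ≠ ∞)
    (hfin : eLpNorm (fun τ => edist τ ^ μ * G τ) p (planeMeasure hk) ≠ ∞) :
    eLpNorm (fun ζ : AffPlane hj => edist ζ ^ ν * lowerDual G ζ) p (planeMeasure hj) ≤
      ENNReal.ofReal ‖T‖ * eLpNorm (fun τ => edist τ ^ μ * G τ) p (planeMeasure hk) := by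
  have hp : 1 ≤ p := Fact.out
  -- Taking real values changes G only where it is infinite, a null set; the cast to 𝕜 then treats
  -- real and complex scalars at once.
  let φ : AffPlane hk → ℝ := fun τ => (G τ).toReal
  have hφ : Measurable φ := hG.ennreal_toReal
  have hφ0 : ∀ τ, 0 ≤ φ τ := fun τ => ENNReal.toReal_nonneg
  have hφG : ∀ᵐ τ ∂(planeMeasure hk), ENNReal.ofReal (φ τ) = G τ := by
    filter_upwards [hGt] with τ hτ using ENNReal.ofReal_toReal hτ
  let Φ : AffPlane hk → 𝕜 := fun τ => (φ τ : 𝕜)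
  have hΦm : Measurable Φ := RCLike.measurable_ofReal.comp hφ
  have hΦ : AEStronglyMeasurable Φ (planeMeasure hk) := hΦm.aestronglyMeasurable
  have hΦe : ∀ τ, ‖Φ τ‖ₑ = ENNReal.ofReal (φ τ) := fun τ => by
    rw [← ofReal_norm, RCLike.norm_ofReal, abs_of_nonneg (hφ0 τ)]
  have hsrc : eLpNorm (fun τ => distPow hk μ τ • Φ τ) p (planeMeasure hk) =
      eLpNorm (fun τ => edist τ ^ μ * G τ) p (planeMeasure hk) := by
    rw [eLpNorm_distPow_smul hkn]
    refine eLpNorm_congr_ae ?_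
    filter_upwards [hφG] with τ hτ
    rw [hΦe, hτ]
  have hmem : MemLp (fun τ => distPow hk μ τ • Φ τ) p (planeMeasure hk) := by
    have hm : Measurable (distPow hk μ) := measurable_dist.pow_const μ
    exact ⟨hm.aestronglyMeasurable.smul hΦ, hsrc ▸ hfin.lt_top⟩
  have htgt : eLpNorm (fun ζ => distPow hj ν ζ • T (WLp.mk Φ hΦ hmem) ζ) p (planeMeasure hj) =
      eLpNorm (fun ζ : AffPlane hj => edist ζ ^ ν * lowerDual G ζ) p (planeMeasure hj) := by
    rw [eLpNorm_distPow_smul (by omega)]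
    refine eLpNorm_congr_ae ?_
    filter_upwards [hT Φ hΦ hmem, ae_dualConverges (hj := hj) hjk hkn hp hP had hΦ hmem,
      ae_ae_planeThrough hjk.le (hj := hj) hφG] with ζ h1 h2 h3
    rw [h1, enorm_dualTransform_ofReal hjk.le hφ0 hφ h2]
    exact congrArg _ (lintegral_congr_ae h3)
  have h := T.le_opNorm (WLp.mk Φ hΦ hmem)
  rw [WLp.norm_def, htgt, WLp.norm_def] at h
  have h2 : eLpNorm (fun τ => distPow hk μ τ • (WLp.mk Φ hΦ hmem : PlaneLp 𝕜 hk p μ) τ) p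
      (planeMeasure hk) = eLpNorm (fun τ => edist τ ^ μ * G τ) p (planeMeasure hk) := by
    refine Eq.trans (eLpNorm_congr_ae ?_) hsrc
    filter_upwards [AEEqFun.coeFn_mk Φ hΦ] with τ hτ
    exact congrArg (distPow hk μ τ • ·) hτ
  rw [h2] at h
  -- Finiteness comes from T taking values in the weighted space. It is needed to lift the real
  -- inequality `h` to extended reals, since `toReal` sends ∞ to 0.
  have hfin' : eLpNorm (fun ζ : AffPlane hj => edist ζ ^ ν * lowerDual G ζ) p (planeMeasure hj) ≠
      ∞ := by
    rw [← htgt]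
    exact (T (WLp.mk Φ hΦ hmem)).2.2.ne
  rw [← ENNReal.ofReal_toReal hfin', ← ENNReal.ofReal_toReal hfin,
    ← ENNReal.ofReal_mul (norm_nonneg _)]
  exact ENNReal.ofReal_le_ofReal h

/-- The test function is |τ|^{-b} cut off at |τ| < 1, with b = a - δ. Multiplication by |τ|^μ and
|ζ|^ν turns the exponents into δ - (n - k)/p and δ - (n - j)/p, the truncated powers with norms s'
and s. Leaving s and s' abstract and allowing δ = 0 covers p = ∞ as well. -/
theorem momentConst_mul_le_opNorm (hjk : j < k) (hkn : k < n) {p : ℝ≥0∞} [Fact (1 ≤ p)]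
    {P μ ν : ℝ} (hP : P = (1 / p).toReal) (hν : ν = μ - (k - j : ℕ) * P)
    (had : (n - k : ℕ) * P + μ < (n - k : ℕ))
    (T : PlaneLp 𝕜 hk p μ →L[𝕜] PlaneLp 𝕜 hj p ν)
    (hT : ∀ (φ : AffPlane hk → 𝕜) (hφ : AEStronglyMeasurable φ (planeMeasure hk))
      (hφμ : MemLp (fun τ => distPow hk μ τ • φ τ) p (planeMeasure hk)),
      T (WLp.mk φ hφ hφμ) =ᵐ[planeMeasure hj] dualTransform φ)
    {δ : ℝ} (hδ : 0 ≤ δ) {s s' : ℝ} (hs' : 0 < s')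
    (hj' : eLpNorm (truncPow (δ - (n - j : ℕ) * P)) p (planeMeasure hj) = ENNReal.ofReal s)
    (hk' : eLpNorm (truncPow (δ - (n - k : ℕ) * P)) p (planeMeasure hk) = ENNReal.ofReal s') :
    momentConst (n - j) (n - k) ((n - k : ℕ) * P + μ - δ) * (s / s') ≤ ‖T‖ := by
  have hdm : ((n - j : ℕ) : ℝ) = (n - k : ℕ) + (k - j : ℕ) := by
    exact_mod_cast (by omega : n - j = (n - k) + (k - j))
  set b := (n - k : ℕ) * P + μ - δ with hb
  have hbd : b < (n - k : ℕ) := by linarith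
  have hM := momentConst_pos (by omega : 0 < n - k) (by omega : n - k ≤ n - j) hbd
  have hsrc : eLpNorm (fun τ : AffPlane hk => edist τ ^ μ * truncPow (-b) τ) p (planeMeasure hk) =
      ENNReal.ofReal s' := by
    rw [← hk']
    refine eLpNorm_congr_ae ?_
    filter_upwards [ae_edist_ne_zero (h := hk) hkn] with τ hτ
    rw [edist_rpow_mul_truncPow _ _ hτ]
    congr 1
    rw [hb]
    ring
  have htop : ∀ᵐ τ ∂(planeMeasure hk), truncPow (-b) τ ≠ ∞ := by
    filter_upwards [ae_edist_ne_zero (h := hk) hkn] with τ hτ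
    by_cases h1 : edist τ < 1
    · rw [truncPow_of_lt _ h1]
      simp [ENNReal.rpow_eq_top_iff, hτ, edist_ne_top]
    · rw [truncPow_of_not_lt _ h1]
      exact ENNReal.zero_ne_top
  have h := eLpNorm_lowerDual_le_opNorm hjk hkn hP had T hT (measurable_truncPow (-b)) htop
    (by rw [hsrc]; exact ENNReal.ofReal_ne_top)
  rw [hsrc] at h
  have htgt : ENNReal.ofReal (momentConst (n - j) (n - k) b) * ENNReal.ofReal s ≤
      eLpNorm (fun ζ : AffPlane hj => edist ζ ^ ν * lowerDual
        (truncPow (-b) : AffPlane hk → ℝ≥0∞) ζ) p (planeMeasure hj) := by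
    -- The passage to real values lets the scalar be pulled out of the seminorm; the truncated power
    -- is finite almost everywhere.
    have hconst : ENNReal.ofReal (momentConst (n - j) (n - k) b) * ENNReal.ofReal s =
        eLpNorm (momentConst (n - j) (n - k) b •
          fun ζ : AffPlane hj => (truncPow (δ - (n - j : ℕ) * P) ζ).toReal) p (planeMeasure hj) := by
      rw [eLpNorm_const_smul, Real.enorm_of_nonneg hM.le, ← hj']
      congr 1
      refine eLpNorm_congr_enorm_ae ?_
      filter_upwards [ae_edist_ne_zero (h := hj) (by omega)] with ζ hζ
      rw [enorm_eq_self, Real.enorm_of_nonneg ENNReal.toReal_nonneg, ENNReal.ofReal_toReal]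
      by_cases h1 : edist ζ < 1
      · rw [truncPow_of_lt _ h1]
        simp [ENNReal.rpow_eq_top_iff, hζ, edist_ne_top]
      · rw [truncPow_of_not_lt _ h1]
        exact ENNReal.zero_ne_top
    rw [hconst]
    refine eLpNorm_mono_enorm_ae ?_
    filter_upwards [ae_edist_ne_zero (h := hj) (by omega)] with ζ hζ
    rw [Pi.smul_apply, enorm_smul, Real.enorm_of_nonneg hM.le,
      Real.enorm_of_nonneg ENNReal.toReal_nonneg, enorm_eq_self]
    calc _ ≤ ENNReal.ofReal (momentConst (n - j) (n - k) b) * (edist ζ ^ ν * truncPow (-b) ζ) := by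
          refine mul_le_mul_right (ENNReal.ofReal_toReal_le.trans_eq ?_) _
          rw [edist_rpow_mul_truncPow _ _ hζ]
          congr 1
          rw [hb, hν, hdm]
          ring
      _ = edist ζ ^ ν * (ENNReal.ofReal (momentConst (n - j) (n - k) b) * truncPow (-b) ζ) := by
          ring
      _ ≤ _ := mul_le_mul_right (le_lowerDual_truncPow hjk hkn hbd hζ) _
  have h3 := htgt.trans h
  rw [← ENNReal.ofReal_mul hM.le, ← ENNReal.ofReal_mul (norm_nonneg _),
    ENNReal.ofReal_le_ofReal_iff (by positivity)] at h3
  rw [← mul_div_assoc, div_le_iff₀ hs']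
  exact h3

theorem continuousAt_momentConst {d d' : ℕ} (hd' : 0 < d') (hd : d' ≤ d) {a : ℝ} (ha : a < d') :
    ContinuousAt (momentConst d d') a := by
  have h1 : (0 : ℝ) < d' := by exact_mod_cast hd'
  have h2 : (d' : ℝ) ≤ d := by exact_mod_cast hd
  have hG : ∀ e : ℝ, a < e → ContinuousAt (fun a => Real.Gamma ((e - a) / 2)) a := by
    intro e he
    have hc : ContinuousAt Real.Gamma ((e - a) / 2) := by
      refine (Real.differentiableAt_Gamma fun m => ?_).continuousAt
      have : (0 : ℝ) ≤ m := Nat.cast_nonneg m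
      linarith
    exact ContinuousAt.comp (f := fun a : ℝ => (e - a) / 2) hc (by fun_prop)
  refine (continuousAt_const.mul (hG _ ha)).div (continuousAt_const.mul (hG _ (by linarith))) ?_
  exact (mul_pos (Real.Gamma_pos_of_pos (by linarith)) (Real.Gamma_pos_of_pos (by linarith))).ne'

/-- For finite p the bound for each δ > 0 tends to the norm constant as δ → 0, the strict inequality
a < n - k keeping M continuous at a. For p = ∞ the cutoff powers with δ = 0 already have norm 1. -/
theorem normConst_le_opNorm (hjk : j < k) (hkn : k < n) {p : ℝ≥0∞} [Fact (1 ≤ p)]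
    {P μ ν : ℝ} (hP : P = (1 / p).toReal) (hν : ν = μ - (k - j : ℕ) * P)
    (had : (n - k : ℕ) * P + μ < (n - k : ℕ))
    (T : PlaneLp 𝕜 hk p μ →L[𝕜] PlaneLp 𝕜 hj p ν)
    (hT : ∀ (φ : AffPlane hk → 𝕜) (hφ : AEStronglyMeasurable φ (planeMeasure hk))
      (hφμ : MemLp (fun τ => distPow hk μ τ • φ τ) p (planeMeasure hk)),
      T (WLp.mk φ hφ hφμ) =ᵐ[planeMeasure hj] dualTransform φ) :
    normConst (n - j) (n - k) P μ ≤ ‖T‖ := by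
  have hp : 1 ≤ p := Fact.out
  have hs := sphereArea_pos (d := n - j) (by omega)
  have hs' := sphereArea_pos (d := n - k) (by omega)
  rcases eq_or_ne p ∞ with rfl | hpt
  · obtain rfl : P = 0 := by simpa using hP
    have h := momentConst_mul_le_opNorm hjk hkn hP hν had T hT le_rfl (s := 1) (s' := 1) one_pos
      (by simpa using eLpNorm_top_truncPow_zero (h := hj) (by omega))
      (by simpa using eLpNorm_top_truncPow_zero (h := hk) hkn)
    simpa [normConst] using h
  · have hp0 : p ≠ 0 := (zero_lt_one.trans_le hp).ne'
    have hpr := ENNReal.toReal_pos hp0 hpt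
    have h : ∀ δ : ℝ, 0 < δ → momentConst (n - j) (n - k) ((n - k : ℕ) * P + μ - δ) *
        (sphereArea (n - j) / sphereArea (n - k)) ^ P ≤ ‖T‖ := by
      intro δ hδ
      have h1 := eLpNorm_truncPow (h := hj) (by omega) hp hpt hδ
      have h2 := eLpNorm_truncPow (h := hk) hkn hp hpt hδ
      rw [← hP] at h1 h2
      have h3 := momentConst_mul_le_opNorm hjk hkn hP hν had T hT hδ.le (by positivity)
        h1 h2
      -- The common factor δp cancels, so only the moment constant still depends on δ.
      rwa [← Real.div_rpow (by positivity) (by positivity),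
        div_div_div_cancel_right₀ (by positivity)] at h3
    have hlim : Filter.Tendsto (fun δ : ℝ => momentConst (n - j) (n - k)
        ((n - k : ℕ) * P + μ - δ) * (sphereArea (n - j) / sphereArea (n - k)) ^ P)
        (nhdsWithin 0 (Set.Ioi 0)) (nhds (normConst (n - j) (n - k) P μ)) := by
      refine Filter.Tendsto.mul_const _ ?_
      refine (continuousAt_momentConst (by omega) (by omega) had).tendsto.comp ?_
      have h0 : Filter.Tendsto (fun δ : ℝ => (n - k : ℕ) * P + μ - δ) (nhds 0)
          (nhds ((n - k : ℕ) * P + μ - 0)) := by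
        exact (continuous_const.sub continuous_id).tendsto 0
      rw [sub_zero] at h0
      exact h0.mono_left nhdsWithin_le_nhds
    exact le_of_tendsto hlim (Filter.eventually_of_mem self_mem_nhdsWithin fun δ hδ => h δ hδ)

end PlaneTransform

end

open PlaneTransform in
theorem theorem4p7 {𝕜 : Type*} [RCLike 𝕜] {n k j : ℕ} (hjk : j < k) (hkn : k < n)
    (p p' : ℝ≥0∞) [Fact (1 ≤ p)] (hpp' : 1 / p + 1 / p' = 1) (μ ν : ℝ)
    (hν : ν = μ - ((k : ℝ) - j) * (1 / p).toReal)
    (hμ : μ < ((n : ℝ) - k) * (1 / p').toReal) :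
    ∃ T : PlaneLp 𝕜 hkn.le p μ →L[𝕜] PlaneLp 𝕜 (hjk.trans hkn).le p ν,
      (∀ (φ : AffPlane hkn.le → 𝕜) (hφ : AEStronglyMeasurable φ (planeMeasure hkn.le))
        (hφμ : MemLp (fun τ => distPow hkn.le μ τ • φ τ) p (planeMeasure hkn.le)),
        (∀ᵐ ζ ∂(planeMeasure (hjk.trans hkn).le), DualConverges φ ζ) ∧
        T (WLp.mk φ hφ hφμ) =ᵐ[planeMeasure (hjk.trans hkn).le] dualTransform φ) ∧
      ‖T‖ = Real.pi ^ (((k : ℝ) - j) / 2) *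
        (sphereArea (n - k) / sphereArea (n - j)) ^ (1 / p').toReal *
        (Real.Gamma ((((n : ℝ) - k) * (1 / p').toReal - μ) / 2) /
          Real.Gamma ((((n : ℝ) - j) * (1 / p').toReal + ((k : ℝ) - j) * (1 / p).toReal - μ) / 2)) := by
  have hP' : (1 / p').toReal = 1 - (1 / p).toReal := by
    have h1 : 1 / p ≠ ∞ := ne_top_of_le_ne_top ENNReal.one_ne_top (le_self_add.trans_eq hpp')
    have h2 : 1 / p' ≠ ∞ := ne_top_of_le_ne_top ENNReal.one_ne_top (le_add_self.trans_eq hpp')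
    rw [eq_sub_iff_add_eq', ← ENNReal.toReal_add h1 h2, hpp', ENNReal.toReal_one]
  have c1 : (n : ℝ) - k = (n - k : ℕ) := (Nat.cast_sub hkn.le).symm
  have c2 : (n : ℝ) - j = (n - j : ℕ) := (Nat.cast_sub (hjk.trans hkn).le).symm
  have c3 : (k : ℝ) - j = (k - j : ℕ) := (Nat.cast_sub hjk.le).symm
  rw [c3] at hν
  rw [c1, hP'] at hμ
  -- This is the hypothesis on μ in the form a < n - k, the condition for the moment of order -a to
  -- be finite.
  have had : ((n - k : ℕ) : ℝ) * (1 / p).toReal + μ < (n - k : ℕ) := by linarith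
  obtain ⟨T, hT, hle⟩ := exists_dualTransform_operator (𝕜 := 𝕜) (hj := (hjk.trans hkn).le)
    (hk := hkn.le) hjk hkn rfl hν had
  refine ⟨T, fun φ hφ hφμ =>
    ⟨ae_dualConverges hjk hkn Fact.out rfl had hφ hφμ, hT φ hφ hφμ⟩, ?_⟩
  rw [c1, c2, c3, hP', ← normConst_eq (by omega) (by omega) had]
  exact le_antisymm hle (normConst_le_opNorm hjk hkn rfl hν had T hT)
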